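/- \textbf{Model.} Let $N\in\mathbb N_0$ be the horizon, let the state space $E$ and the action space $A$ be Borel spaces (Borel subsets of Polish spaces), and let $(\mathcal Z,\mathfrak Z)$ be a measurable space. For $n=0,\dots,N-1$ let $D_n\subseteq E\times A$ be measurable and contain the graph of a measurable map $E\to A$, put $D_n(x)=\{a:(x,a)\in D_n\}$, and let $T_n:D_n\times\mathcal Z\to E$ be measurable, $c_n:D_n\times E\to\mathbb R$ and $c_N:E\to\mathbb R$. Let $P_{n+1}$ be a separable probability measure on $\mathcal Z$, let $q\in(1,\infty]$, $\frac1p+\frac1q=1$, and let the ambiguity set $\mathcal Q_{n+1}$ be a non-empty set of probability measures $Q\ll P_{n+1}$ with $dQ/dP_{n+1}\in L^q(P_{n+1})$. Identify $\mathcal Q_{n+1}$ with its set of densities and give it the trace of the weak* topology $\sigma(L^q,L^p)$ and the corresponding Borel $\sigma$-algebra. Let $H_n$ be the set of histories $h_n=(x_0,a_0,x_1,\dots,a_{n-1},x_n)$ with $a_k\in D_k(x_k)$. A randomized policy $\pi\in\Pi^R$ is a sequence of stochastic kernels $\pi_n$ from $H_n$ to $A$ ($n<N$) with $\pi_n(D_n(x_n)\mid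 h_n)=1$; a Markov policy $\pi\in\Pi^M\subseteq\Pi^R$ is a sequence of measurable maps $d_n:E\to A$ with $d_n(x)\in D_n(x)$. A policy of nature $\gamma\in\Gamma$ is a sequence of measurable maps $\gamma_n:\{(h_n,a_n):h_n\in H_n,\ a_n\in D_n(x_n)\}\to\mathcal Q_{n+1}$; it is Markov ($\gamma\in\Gamma^M$) if it is given by measurable maps $\gamma_n:D_n\to\mathcal Q_{n+1}$. Given $h_n$, the process evolves by $a_k\sim\pi_k(\cdot\mid h_k)$, $z_{k+1}\sim\gamma_k(h_k,a_k)$, $x_{k+1}=T_k(x_k,a_k,z_{k+1})$; let $\mathbb E^{\pi\gamma}_{nh_n}$ be the corresponding expectation and $$V_{n\pi\gamma}(h_n)=\mathbb E^{\pi\gamma}_{nh_n}\Big[\sum_{k=n}^{N-1}c_k(X_k,A_k,X_{k+1})+c_N(X_N)\Big],\quad V_{n\pi}=\sup_{\gamma\in\Gamma}V_{n\pi\gamma},\quad V_n=\inf_{\pi\in\Pi^R}V_{n\pi}.$$ For $v:E\to\mathbb R$ write $$L_nv(x,a,Q)=\int c_n(x,a,T_n(x,a,z))+v(T_n(x,a,z))\,Q(dz),\qquad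 \mathcal T_nv(x)=\inf_{a\in D_n(x)}\sup_{Q\in\mathcal Q_{n+1}}L_nv(x,a,Q),$$ $\mathcal T_{nd}v(x)=\sup_{Q\in\mathcal Q_{n+1}}L_nv(x,d(x),Q)$ and $\mathcal T_{nd\gamma}v(x)=L_nv(x,d(x),\gamma(x,d(x)))$. For $\pi=(d_n)\in\Pi^M$ and $\gamma\in\Gamma^M$ let $J_{N\pi\gamma}=c_N$, $J_{n\pi\gamma}=\mathcal T_{nd_n\gamma_n}J_{n+1,\pi\gamma}$, and put $J_{n\pi}=\sup_{\gamma\in\Gamma^M}J_{n\pi\gamma}$, $J_n=\inf_{\pi\in\Pi^M}J_{n\pi}$. \textbf{Assumptions.} For all $n=0,\dots,N-1$: (A) The sets $D_n(x)$ are compact, and if $x_k\to x$ and $a_k\in D_n(x_k)$, then $(a_k)$ has an accumulation point in $D_n(x)$; $(x,a)\mapsto T_n(x,a,z)$ is continuous for every $z$; $c_n$ and $c_N$ are lower semicontinuous. (B) There are $\alpha,\underline\epsilon,\bar\epsilon\ge0$ with $\alpha\ne1$, $\underline\epsilon+\bar\epsilon=1$, and measurable $\underline b:E\to(-\infty,-\underline\epsilon]$,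 $\bar b:E\to[\bar\epsilon,\infty)$ such that for all $(x,a)\in D_n$, $Q\in\mathcal Q_{n+1}$, with $x'=T_n(x,a,z)$ and $z\sim Q$, $$\mathbb E^Q[-c_n^-(x,a,x')]\ge\underline b(x),\quad \mathbb E^Q[\underline b(x')]\ge\alpha\underline b(x),\quad \mathbb E^Q[c_n^+(x,a,x')]\le\bar b(x),\quad \mathbb E^Q[\bar b(x')]\le\alpha\bar b(x),$$ and $\underline b\le c_N\le\bar b$. (C) With $b=\bar b-\underline b$: every $(\bar x,\bar a)\in D_n$ has a neighbourhood $U$ and measurable $\Theta_1,\Theta_2:\mathcal Z\to\mathbb R_+$ in $L^p(P_{n+1})$ with $|c_n(x,a,T_n(x,a,z))|\le\Theta_1(z)$ and $b(T_n(x,a,z))\le\Theta_2(z)$ for all $(x,a)\in U\cap D_n$, $z\in\mathcal Z$. (D) The densities $dQ/dP_{n+1}$, $Q\in\mathcal Q_{n+1}$, $n=0,\dots,N-1$, are bounded in $L^q$-norm by a common constant. Let $\mathbb B$ be the set of lower semicontinuous $v:E\to\mathbb R$ with $|v|\le\lambda b$ for some $\lambda\ge0$. \textbf{Theorem.} Under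 (A)--(D) all the expectations and integrals above that define $V_{n\pi\gamma}$ and $L_nJ_{n+1}$ are integrals of integrable functions, $V_{n\pi\gamma}(h_n)=J_{n\pi\gamma}(x_n)$ for $\pi\in\Pi^M$, $\gamma\in\Gamma^M$, and the following holds. a) For all $n=0,\dots,N$ and $h_n\in H_n$ we have $V_n(h_n)=J_n(x_n)$. Moreover $J_n\in\mathbb B$, $J_N=c_N$, and $J_n=\mathcal T_nJ_{n+1}$ for $n<N$. For every $n<N$ there is a Markov minimizer of $J_{n+1}$, i.e. a measurable $d_n^*:E\to A$ with $d_n^*(x)\in D_n(x)$ and $\mathcal T_{nd_n^*}J_{n+1}=\mathcal T_nJ_{n+1}$, and every sequence of such minimizers is an optimal policy $\pi^*=(d_0^*,\dots,d_{N-1}^*)$ of the controller: $J_{n\pi^*}=J_n$ and $V_{n\pi^*}=V_n$ for all $n\le N$. b) Suppose in addition that all the sets $\mathcal Q_{n+1}$ are weak* closed in $L^q(P_{n+1})$. Then for every $n<N$ there is a maximizing Markov decision rule $\gamma_n^*:D_n\to\mathcal Q_{n+1}$ of nature, i.e. $L_nJ_{n+1}(x,a,\gamma_n^*(x,a))=\max_{Q\in\mathcal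 Q_{n+1}}L_nJ_{n+1}(x,a,Q)$ on $D_n$, so that $J_n=\mathcal T_{nd_n^*\gamma_n^*}J_{n+1}$ for every Markov minimizer $d_n^*$. For every sequence $\pi^*$ of Markov minimizers, every $\gamma^*\in\Gamma^M$ with $J_n=\mathcal T_{nd_n^*\gamma_n^*}J_{n+1}$ for all $n<N$ is an optimal policy of nature: $J_n=J_{n\pi^*\gamma^*}$ and $V_{n\pi^*\gamma^*}=V_{n\pi^*}$ for all $n\le N$. -/

import Mathlib

open MeasureTheory ProbabilityTheory Filter Topology
open scoped ENNReal

noncomputable section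

/-- The weak* topology `σ(L^q, L^p)` on `L^q(μ)`: the coarsest topology for which
`f ↦ ∫ f g dμ` is continuous for every `g ∈ L^p(μ)`. -/
@[reducible] def weakStarTopology {Z : Type*} [MeasurableSpace Z] (μ : Measure Z) (p q : ℝ≥0∞) :
    TopologicalSpace (Lp ℝ q μ) :=
  TopologicalSpace.induced (fun (f : Lp ℝ q μ) (g : Lp ℝ p μ) => ∫ z, f z * g z ∂μ)
    inferInstance

/-- A distributionally robust Markov decision model with planning horizon `N`, state space `E`,
action space `A` and disturbance space `Z`. The stages are `k : Fin N`, i.e. `k = 0, …, N - 1`;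
points in time are `n : Fin (N + 1)`, i.e. `n = 0, …, N`. -/
structure RobustMDP (N : ℕ) (E A Z : Type*) [MeasurableSpace E] [MeasurableSpace A]
    [MeasurableSpace Z] where
  /-- admissible state-action pairs `D_k ⊆ E × A` -/
  D : Fin N → Set (E × A)
  measurableSet_D : ∀ k, MeasurableSet (D k)
  /-- `D_k` contains the graph of a measurable map -/
  exists_graph : ∀ k, ∃ d : E → A, Measurable d ∧ ∀ x, (x, d x) ∈ D k
  /-- transition functions `T_k : D_k × Z → E` -/
  T : (k : Fin N) → D k × Z → E
  measurable_T : ∀ k, Measurable (T k)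
  /-- one-stage costs `c_k(x, a, x')` -/
  c : (k : Fin N) → D k × E → ℝ
  /-- terminal cost `c_N` -/
  cN : E → ℝ
  /-- `P k` is the reference law of the disturbance `Z_{k+1}` acting between the times `k` and
  `k + 1` -/
  P : Fin N → Measure Z
  isProbabilityMeasure_P : ∀ k, IsProbabilityMeasure (P k)
  isSeparable_P : ∀ k, IsSeparable (P k)
  /-- conjugate exponents, with `q ∈ (1, ∞]` -/
  p : ℝ≥0∞
  q : ℝ≥0∞
  one_lt_q : 1 < q
  holderConjugate : p.HolderConjugate q
  /-- `ambiguity k` is the ambiguity set `𝒬_{k+1}` of possible laws of `Z_{k+1}` -/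
  ambiguity : Fin N → Set (Measure Z)
  ambiguity_nonempty : ∀ k, (ambiguity k).Nonempty
  isProbabilityMeasure_ambiguity : ∀ k, ∀ Q ∈ ambiguity k, IsProbabilityMeasure Q
  absolutelyContinuous_ambiguity : ∀ k, ∀ Q ∈ ambiguity k, Q ≪ P k
  memLp_ambiguity : ∀ k, ∀ Q ∈ ambiguity k,
    MemLp (fun z => (Q.rnDeriv (P k) z).toReal) q (P k)

theorem measurable_finSnoc {n : ℕ} {R B : Type*} [MeasurableSpace R] [MeasurableSpace B]
    {f : R → Fin n → B} {g : R → B} (hf : Measurable f) (hg : Measurable g) :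
    Measurable fun r => (Fin.snoc (α := fun _ => B) (f r) (g r) : Fin (n + 1) → B) := by
  refine measurable_pi_iff.mpr fun j => ?_
  refine Fin.lastCases ?_ (fun j => ?_) j
  · simpa only [Fin.snoc_last] using hg
  · simpa only [Fin.snoc_castSucc] using measurable_pi_iff.mp hf j

namespace RobustMDP

variable {N : ℕ} {E A Z : Type*} [MeasurableSpace E] [MeasurableSpace A] [MeasurableSpace Z]
  (M : RobustMDP N E A Z)

/-! ### Ambiguity sets as topological and measurable spaces -/

/-- The ambiguity set `𝒬_{k+1}` as a type. It carries the weak* trace topology and its Borel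
`σ`-algebra. -/
structure Amb (k : Fin N) where
  measure : Measure Z
  mem : measure ∈ M.ambiguity k

instance {k : Fin N} (Q : M.Amb k) : IsProbabilityMeasure Q.measure :=
  M.isProbabilityMeasure_ambiguity k Q.measure Q.mem

variable {M} in
/-- the density `dQ/dP_{k+1}` as an element of `L^q(P_{k+1})` -/
def Amb.density {k : Fin N} (Q : M.Amb k) : Lp ℝ M.q (M.P k) :=
  (M.memLp_ambiguity k Q.measure Q.mem).toLp

instance (k : Fin N) : TopologicalSpace (M.Amb k) :=
  TopologicalSpace.induced Amb.density (weakStarTopology (M.P k) M.p M.q)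

instance (k : Fin N) : MeasurableSpace (M.Amb k) := borel (M.Amb k)

/-- The ambiguity set `𝒬_{k+1}`, identified with its set of densities, is weak* closed in `L^q`. -/
def WeakStarClosed (k : Fin N) : Prop :=
  IsClosed[weakStarTopology (M.P k) M.p M.q] (Set.range (Amb.density : M.Amb k → _))

/-- The identity, from the weak* Borel `σ`-algebra to the space of measures, is measurable. -/
theorem measurable_amb_measure (k : Fin N) :
    Measurable (Amb.measure : M.Amb k → Measure Z) := by
  have := M.isProbabilityMeasure_P k
  refine Measure.measurable_of_measurable_coe _ fun B hB => ?_
  have hB' : MemLp (B.indicator fun _ => (1 : ℝ)) M.p (M.P k) :=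
    memLp_indicator_const _ hB _ (Or.inr (measure_ne_top _ _))
  have hc : Continuous fun Q : M.Amb k => ∫ z, Q.density z * hB'.toLp _ z ∂(M.P k) := by
    refine (continuous_apply (hB'.toLp _)).comp (?_ : Continuous fun Q : M.Amb k =>
      fun g : Lp ℝ M.p (M.P k) => ∫ z, Q.density z * g z ∂(M.P k))
    rw [continuous_iff_le_induced]
    exact (induced_compose
      (g := fun (f : Lp ℝ M.q (M.P k)) (g : Lp ℝ M.p (M.P k)) => ∫ z, f z * g z ∂(M.P k))
      (f := (Amb.density : M.Amb k → _))).le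
  have hm : Measurable fun Q : M.Amb k => ∫ z, Q.density z * hB'.toLp _ z ∂(M.P k) := by
    have : BorelSpace (M.Amb k) := ⟨rfl⟩
    exact hc.measurable
  have key : ∀ Q : M.Amb k,
      Q.measure B = ENNReal.ofReal (∫ z, Q.density z * hB'.toLp _ z ∂(M.P k)) := by
    intro Q
    have h1 : ∫ z, Q.density z * hB'.toLp _ z ∂(M.P k) = Q.measure.real B := by
      rw [← Measure.setIntegral_toReal_rnDeriv (M.absolutelyContinuous_ambiguity k Q.measure Q.mem) B,
        ← integral_indicator hB]
      refine integral_congr_ae ?_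
      filter_upwards [(M.memLp_ambiguity k Q.measure Q.mem).coeFn_toLp, hB'.coeFn_toLp] with z h2 h3
      rw [h3]
      unfold Amb.density
      rw [h2]
      by_cases hz : z ∈ B <;> simp [hz]
    rw [h1, Measure.real, ENNReal.ofReal_toReal (measure_ne_top _ _)]
  simp_rw [key]
  exact hm.ennreal_ofReal

/-! ### Histories -/

/-- The set `H_n` of feasible histories `(x_0, a_0, x_1, …, a_{n-1}, x_n)`: the states
`x_0, …, x_n` and the actions `a_0, …, a_{n-1}`, with `a_j ∈ D_j(x_j)`. -/
abbrev Hist (n : Fin (N + 1)) : Type _ :=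
  {h : (Fin (n.val + 1) → E) × (Fin n.val → A) //
    ∀ j : Fin n.val, (h.1 j.castSucc, h.2 j) ∈ M.D ⟨j, by omega⟩}

variable {M} in
/-- the current state `x_n` of a history `h_n` -/
def Hist.last {n : Fin (N + 1)} (h : M.Hist n) : E := h.1.1 (Fin.last n.val)

theorem measurable_last (n : Fin (N + 1)) : Measurable (Hist.last : M.Hist n → E) :=
  (measurable_pi_apply _).comp (measurable_fst.comp measurable_subtype_coe)

/-- Histories up to time `k` together with an admissible action: `(h_k, a_k)` with
`a_k ∈ D_k(x_k)`. -/
abbrev HistAct (k : Fin N) : Type _ :=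
  {r : M.Hist k.castSucc × A // (r.1.last, r.2) ∈ M.D k}

variable {M} in
/-- the current state-action pair `(x_k, a_k) ∈ D_k` -/
def HistAct.pair {k : Fin N} (r : M.HistAct k) : M.D k := ⟨(r.1.1.last, r.1.2), r.2⟩

theorem measurable_pair (k : Fin N) : Measurable (HistAct.pair : M.HistAct k → M.D k) :=
  (((M.measurable_last _).comp (measurable_fst.comp measurable_subtype_coe)).prodMk
    (measurable_snd.comp measurable_subtype_coe)).subtype_mk

theorem measurableEmbedding_histAct (k : Fin N) :
    MeasurableEmbedding (Subtype.val : M.HistAct k → M.Hist k.castSucc × A) :=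
  MeasurableEmbedding.subtype_coe
    ((M.measurableSet_D k).preimage
      (((M.measurable_last _).comp measurable_fst).prodMk measurable_snd))

/-- The successor history `(h_k, a_k, x_{k+1})` with `x_{k+1} = T_k(x_k, a_k, z)`. -/
def next (k : Fin N) (r : M.HistAct k × Z) : M.Hist k.succ :=
  ⟨(Fin.snoc (α := fun _ => E) r.1.1.1.1.1 (M.T k (r.1.pair, r.2)),
      Fin.snoc (α := fun _ => A) r.1.1.1.1.2 r.1.1.2), by
    intro j
    refine Fin.lastCases (n := k.val) ?_ (fun j => ?_) j
    · have h := r.1.2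
      simp only [Fin.snoc_last, Fin.snoc_castSucc]
      exact h
    · have h := r.1.1.1.2 j
      simp only [Fin.snoc_castSucc]
      exact h⟩

theorem measurable_next (k : Fin N) : Measurable (M.next k) := by
  have hh : Measurable fun r : M.HistAct k × Z => r.1.1.1.1 :=
    measurable_subtype_coe.comp
      (measurable_fst.comp (measurable_subtype_coe.comp measurable_fst))
  have hT : Measurable fun r : M.HistAct k × Z => M.T k (r.1.pair, r.2) :=
    (M.measurable_T k).comp (((M.measurable_pair k).comp measurable_fst).prodMk measurable_snd)
  have ha : Measurable fun r : M.HistAct k × Z => r.1.1.2 :=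
    measurable_snd.comp (measurable_subtype_coe.comp measurable_fst)
  exact Measurable.subtype_mk
    ((measurable_finSnoc (measurable_fst.comp hh) hT).prodMk
      (measurable_finSnoc (measurable_snd.comp hh) ha))

/-! ### Policies -/

/-- randomized decision rules of the controller: stochastic kernels from `H_k` to `A` with
`π_k(D_k(x_k) | h_k) = 1` -/
structure RandRule (k : Fin N) where
  toKernel : Kernel (M.Hist k.castSucc) A
  isMarkovKernel : IsMarkovKernel toKernel
  feasible : ∀ h : M.Hist k.castSucc, toKernel h {a | (h.last, a) ∈ M.D k} = 1

/-- the set `Π^R` of randomized policies of the controller -/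
abbrev RandPolicy : Type _ := (k : Fin N) → M.RandRule k

/-- deterministic Markov decision rules of the controller -/
structure MarkovRule (k : Fin N) where
  toFun : E → A
  measurable : Measurable toFun
  feasible : ∀ x, (x, toFun x) ∈ M.D k

/-- the set `Π^M` of deterministic Markov policies of the controller -/
abbrev MarkovPolicy : Type _ := (k : Fin N) → M.MarkovRule k

variable {M} in
/-- the admissible pair `(x, d(x))` -/
def MarkovRule.pair {k : Fin N} (d : M.MarkovRule k) (x : E) : M.D k := ⟨(x, d.toFun x), d.feasible x⟩

variable {M} in
/-- a deterministic Markov rule as the Dirac kernel `δ_{d(x_k)}` -/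
def MarkovRule.toRand {k : Fin N} (d : M.MarkovRule k) : M.RandRule k :=
  { toKernel := Kernel.deterministic (fun h => d.toFun h.last)
      (d.measurable.comp (M.measurable_last _))
    isMarkovKernel := inferInstance
    feasible := fun h => by
      have hs : MeasurableSet {a | (h.last, a) ∈ M.D k} :=
        (M.measurableSet_D k).preimage measurable_prodMk_left
      rw [Kernel.deterministic_apply, Measure.dirac_apply' _ hs]
      exact Set.indicator_of_mem (s := {a | (h.last, a) ∈ M.D k}) (d.feasible h.last) _ }

variable {M} in
/-- the inclusion `Π^M ⊆ Π^R` -/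
def MarkovPolicy.toRand (π : M.MarkovPolicy) : M.RandPolicy := fun k => (π k).toRand

/-- decision rules of nature: measurable maps `(h_k, a_k) ↦ γ_k(h_k, a_k) ∈ 𝒬_{k+1}` -/
structure NatRule (k : Fin N) where
  toFun : M.HistAct k → M.Amb k
  measurable : Measurable toFun

/-- the set `Γ` of policies of nature -/
abbrev NatPolicy : Type _ := (k : Fin N) → M.NatRule k

/-- Markov decision rules of nature: measurable maps `D_k → 𝒬_{k+1}` -/
structure NatMarkovRule (k : Fin N) where
  toFun : M.D k → M.Amb k
  measurable : Measurable toFun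

/-- the set `Γ^M` of Markov policies of nature -/
abbrev NatMarkovPolicy : Type _ := (k : Fin N) → M.NatMarkovRule k

variable {M} in
/-- the inclusion `Γ^M ⊆ Γ` -/
def NatMarkovPolicy.toNat (γ : M.NatMarkovPolicy) : M.NatPolicy := fun k =>
  ⟨fun r => (γ k).toFun r.pair, (γ k).measurable.comp (M.measurable_pair k)⟩

/-! ### Law of motion and values -/

variable {M} in
/-- the controller's rule as a kernel from histories to histories with admissible action -/
def RandRule.kernel {k : Fin N} (κ : M.RandRule k) :
    Kernel (M.Hist k.castSucc) (M.HistAct k) :=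
  (Kernel.id ×ₖ κ.toKernel).comapRight (M.measurableEmbedding_histAct k)

variable {M} in
/-- nature's rule as a kernel from histories with admissible action to the disturbance space -/
def NatRule.kernel {k : Fin N} (γ : M.NatRule k) : Kernel (M.HistAct k) Z where
  toFun r := (γ.toFun r).measure
  measurable' := (M.measurable_amb_measure k).comp γ.measurable

/-- One stage of the process: draw `a_k` from `π_k(· | h_k)`, then `z_{k+1}` from
`γ_k(· | h_k, a_k)`, and move to `(h_k, a_k, T_k(x_k, a_k, z_{k+1}))`. -/
def step {k : Fin N} (κ : M.RandRule k) (γ : M.NatRule k) :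
    Kernel (M.Hist k.castSucc) (M.Hist k.succ) :=
  ((Kernel.id ×ₖ γ.kernel).map (M.next k)) ∘ₖ κ.kernel

/-- The law of motion from time `n` on: the conditional distribution, under the policies `π` and
`γ`, of the complete history `H_N` given `H_n = h_n`, obtained by composing the stages
`n, …, N - 1`. -/
def law (π : M.RandPolicy) (γ : M.NatPolicy) (n : Fin (N + 1)) :
    Kernel (M.Hist n) (M.Hist (Fin.last N)) :=
  Fin.reverseInduction (motive := fun n => Kernel (M.Hist n) (M.Hist (Fin.last N)))
    Kernel.id (fun k κ => κ ∘ₖ M.step (π k) (γ k)) n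

/-- the state-action pair `(x_k, a_k)` of a complete history -/
def pairAt (h : M.Hist (Fin.last N)) (k : Fin N) : M.D k :=
  ⟨(h.1.1 k.castSucc, h.1.2 k), h.2 k⟩

/-- the cost `∑_{k=n}^{N-1} c_k(x_k, a_k, x_{k+1}) + c_N(x_N)` from time `n` on -/
def totalCost (n : Fin (N + 1)) (h : M.Hist (Fin.last N)) : ℝ :=
  ∑ k : Fin N, (if n.val ≤ k.val then M.c k (M.pairAt h k, h.1.1 k.succ) else 0) + M.cN h.last

/-- the value `V_{nπγ}(h_n)` of a policy pair -/
def policyValue (π : M.RandPolicy) (γ : M.NatPolicy) (n : Fin (N + 1)) (h : M.Hist n) : ℝ :=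
  ∫ h', M.totalCost n h' ∂(M.law π γ n h)

/-- the robust value `V_{nπ}(h_n) = sup_{γ ∈ Γ} V_{nπγ}(h_n)` of a policy -/
def robustPolicyValue (π : M.RandPolicy) (n : Fin (N + 1)) (h : M.Hist n) : EReal :=
  ⨆ γ : M.NatPolicy, (M.policyValue π γ n h : EReal)

/-- the value function `V_n(h_n) = inf_{π ∈ Π^R} sup_{γ ∈ Γ} V_{nπγ}(h_n)` -/
def robustValue (n : Fin (N + 1)) (h : M.Hist n) : EReal :=
  ⨅ π : M.RandPolicy, M.robustPolicyValue π n h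

/-! ### Operators and Markovian values -/

/-- `L_k v(x, a, Q) = ∫ c_k(x, a, T_k(x, a, z)) + v(T_k(x, a, z)) Q(dz)` -/
def L (k : Fin N) (v : E → ℝ) (y : M.D k) (Q : M.Amb k) : ℝ :=
  ∫ z, (M.c k (y, M.T k (y, z)) + v (M.T k (y, z))) ∂Q.measure

/-- `𝒯_{kdγ} v(x) = L_k v(x, d(x), γ(x, d(x)))` -/
def opPair (k : Fin N) (d : M.MarkovRule k) (γ : M.NatMarkovRule k) (v : E → ℝ) (x : E) : ℝ :=
  M.L k v (d.pair x) (γ.toFun (d.pair x))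

/-- `𝒯_{kd} v(x) = sup_Q L_k v(x, d(x), Q)` -/
def opRule (k : Fin N) (d : M.MarkovRule k) (v : E → ℝ) (x : E) : EReal :=
  ⨆ Q : M.Amb k, (M.L k v (d.pair x) Q : EReal)

/-- the robust Bellman operator `𝒯_k v(x) = inf_{a ∈ D_k(x)} sup_Q L_k v(x, a, Q)` -/
def op (k : Fin N) (v : E → ℝ) (x : E) : EReal :=
  ⨅ a : {a : A // (x, a) ∈ M.D k}, ⨆ Q : M.Amb k, (M.L k v ⟨(x, a.1), a.2⟩ Q : EReal)

/-- `d` is a Markov minimizer of `v` at stage `k`: `𝒯_{kd} v = 𝒯_k v` -/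
def IsMinimizer (k : Fin N) (v : E → ℝ) (d : M.MarkovRule k) : Prop :=
  ∀ x, M.opRule k d v x = M.op k v x

/-- The value `J_{nπγ}(x)` of a pair of Markov policies: `J_{Nπγ} = c_N` and
`J_{kπγ} = 𝒯_{k d_k γ_k} J_{k+1,πγ}`. -/
def markovPolicyValue (π : M.MarkovPolicy) (γ : M.NatMarkovPolicy) (n : Fin (N + 1)) : E → ℝ :=
  Fin.reverseInduction (motive := fun _ => E → ℝ) M.cN
    (fun k v => M.opPair k (π k) (γ k) v) n

/-- `J_{nπ}(x) = sup_{γ ∈ Γ^M} J_{nπγ}(x)` -/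
def robustMarkovPolicyValue (π : M.MarkovPolicy) (n : Fin (N + 1)) (x : E) : EReal :=
  ⨆ γ : M.NatMarkovPolicy, (M.markovPolicyValue π γ n x : EReal)

/-- the Markovian value function `J_n(x) = inf_{π ∈ Π^M} sup_{γ ∈ Γ^M} J_{nπγ}(x)` -/
def markovValue (n : Fin (N + 1)) (x : E) : EReal :=
  ⨅ π : M.MarkovPolicy, M.robustMarkovPolicyValue π n x

/-! ### Assumptions -/

/-- Continuity and compactness properties of the model data. -/
structure ContinuityCompactness [TopologicalSpace E] [TopologicalSpace A] : Prop where
  isCompact_section : ∀ k x, IsCompact {a | (x, a) ∈ M.D k}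
  /-- upper semicontinuity of `x ↦ D_k(x)` -/
  upperSemicontinuous_section : ∀ (k : Fin N) (x : ℕ → E) (a : ℕ → A) (x₀ : E),
    Tendsto x atTop (𝓝 x₀) → (∀ i, (x i, a i) ∈ M.D k) →
      ∃ a₀, (x₀, a₀) ∈ M.D k ∧ MapClusterPt a₀ atTop a
  continuous_T : ∀ k z, Continuous fun y : M.D k => M.T k (y, z)
  lowerSemicontinuous_c : ∀ k, LowerSemicontinuous (M.c k)
  lowerSemicontinuous_cN : LowerSemicontinuous M.cN

/-- Bounding functions `bl ≤ 0 ≤ bu` with growth constant `α`, local `L^p`-bounds, and norm-bounded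
ambiguity sets. Expectations of nonnegative quantities are Lebesgue integrals with values in
`[0, ∞]`; `ENNReal.ofReal t` and `ENNReal.ofReal (-t)` are the positive and the negative part of
`t`. -/
structure Bounding [TopologicalSpace E] [TopologicalSpace A] (α εl εu : ℝ) (bl bu : E → ℝ) :
    Prop where
  α_nonneg : 0 ≤ α
  α_ne_one : α ≠ 1
  εl_nonneg : 0 ≤ εl
  εu_nonneg : 0 ≤ εu
  ε_add : εl + εu = 1
  measurable_bl : Measurable bl
  measurable_bu : Measurable bu
  bl_le : ∀ x, bl x ≤ -εl
  le_bu : ∀ x, εu ≤ bu x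
  /-- `E^Q[-c_k^-(x, a, T_k(x, a, Z_{k+1}))] ≥ bl(x)` -/
  cost_lower : ∀ (k : Fin N) (Q : M.Amb k) (y : M.D k),
    ∫⁻ z, ENNReal.ofReal (-M.c k (y, M.T k (y, z))) ∂Q.measure ≤ ENNReal.ofReal (-bl y.1.1)
  /-- `E^Q[bl(T_k(x, a, Z_{k+1}))] ≥ α bl(x)` -/
  drift_lower : ∀ (k : Fin N) (Q : M.Amb k) (y : M.D k),
    ∫⁻ z, ENNReal.ofReal (-bl (M.T k (y, z))) ∂Q.measure ≤ ENNReal.ofReal (-(α * bl y.1.1))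
  /-- `E^Q[c_k^+(x, a, T_k(x, a, Z_{k+1}))] ≤ bu(x)` -/
  cost_upper : ∀ (k : Fin N) (Q : M.Amb k) (y : M.D k),
    ∫⁻ z, ENNReal.ofReal (M.c k (y, M.T k (y, z))) ∂Q.measure ≤ ENNReal.ofReal (bu y.1.1)
  /-- `E^Q[bu(T_k(x, a, Z_{k+1}))] ≤ α bu(x)` -/
  drift_upper : ∀ (k : Fin N) (Q : M.Amb k) (y : M.D k),
    ∫⁻ z, ENNReal.ofReal (bu (M.T k (y, z))) ∂Q.measure ≤ ENNReal.ofReal (α * bu y.1.1)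
  terminal : ∀ x, bl x ≤ M.cN x ∧ M.cN x ≤ bu x
  /-- local `L^p`-bounds; a neighbourhood is the same as a small closed ball with respect to any
  metric for the product topology -/
  local_bound : ∀ (k : Fin N) (y₀ : M.D k), ∃ U ∈ 𝓝 y₀.1, ∃ Θ₁ Θ₂ : Z → ℝ,
    Measurable Θ₁ ∧ Measurable Θ₂ ∧ (∀ z, 0 ≤ Θ₁ z) ∧ (∀ z, 0 ≤ Θ₂ z) ∧
    MemLp Θ₁ M.p (M.P k) ∧ MemLp Θ₂ M.p (M.P k) ∧
    ∀ y : M.D k, y.1 ∈ U → ∀ z,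
      |M.c k (y, M.T k (y, z))| ≤ Θ₁ z ∧ bu (M.T k (y, z)) - bl (M.T k (y, z)) ≤ Θ₂ z
  /-- uniform bound on the `L^q`-norms of the densities -/
  norm_bound : ∃ K : ℝ, 1 ≤ K ∧ ∀ (k : Fin N) (Q : M.Amb k),
    eLpNorm (fun z => (Q.measure.rnDeriv (M.P k) z).toReal) M.q (M.P k) ≤ ENNReal.ofReal K

end RobustMDP

/-- The space `𝔹` of lower semicontinuous (measurable) functions `v` with `|v| ≤ lam * b` for some
`lam ≥ 0`. -/
def LscBounded {E : Type*} [TopologicalSpace E] [MeasurableSpace E] (b : E → ℝ) : Set (E → ℝ) :=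
  {v | Measurable v ∧ LowerSemicontinuous v ∧ ∃ lam : ℝ, 0 ≤ lam ∧ ∀ x, |v x| ≤ lam * b x}

end

/-!
# Bellman equation and optimal policies for distributionally robust Markov decision models

The Bellman equation `J_N = c_N`, `J_k = 𝒯_k J_{k+1}` is solved backwards inside the space `𝔹` of
lower semicontinuous functions bounded by a multiple of `b = bu - bl`, and its solution is then
compared with the values of policies.

*One step.* Let `v ∈ 𝔹`. For a fixed law `Q`, Fatou's lemma and the local `L^p`-bounds make
`(x, a) ↦ L_k v(x, a, Q)` lower semicontinuous, hence so is the supremum `worstCase` over `Q`; the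
growth conditions bound it by a multiple of `b`. As `x ↦ D_k(x)` is compact-valued and upper
semicontinuous, the infimum over `a` is attained, is again in `𝔹` (`Bounding.exists_op_eq`), and has
a measurable minimizer. The latter comes from an elementary selection theorem
(`CompactMultifunction.exists_selector`): for a compact-valued multifunction with measurable hit
sets, minimizing successively a sequence of continuous functions that separates points singles out
one measurable selector, and the minimizers of a suitable function form such a multifunction
(`CompactMultifunction.argmin`).

*Nature.* For a fixed pair `(x, a)` the integrand of `L_k v` lies in `L^p`, so `L_k v(x, a, ·)` is
weak* continuous. Since `L^p` is separable and the densities are norm-bounded, the weak* topology of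
the ambiguity set is second countable, so nature has `ε`-optimal Markov rules with values in a
countable dense set (`Bounding.exists_natMarkovRule_le_add`). A weak* closed ambiguity set is compact
(`Amb.compactSpace`, through the Riesz representation `exists_Lp_forall_eq_integral` of the dual of
`L^p`), and the selection theorem gives optimal Markov rules (`Bounding.exists_natMarkovRule_isMax`).

*Policies.* The law of motion keeps the past fixed (`ae_law_extends`), the total costs are
integrable by the growth conditions, and the values satisfy a backward recursion
(`Bounding.policyValue_castSucc`). By induction, Markov minimizers guarantee at most `J` against
every policy of nature (`IsBellmanSolution.policyValue_le`), while stagewise `ε`-optimal Markov rules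
of nature guarantee at least `J` minus a multiple of `ε` against every randomized policy
(`IsBellmanSolution.le_policyValue`). As the rules of nature in the second bound are Markov, both
bounds hold for history-dependent and for Markov policies, and the two value functions coincide
with `J`.
-/

noncomputable section

set_option linter.unusedSectionVars false

/-! ### Measurable selection from compact-valued maps -/

/-- A multifunction with nonempty compact values whose hit sets of closed sets are measurable. -/
structure CompactMultifunction {X Y : Type*} [MeasurableSpace X] [TopologicalSpace Y]
    (Φ : X → Set Y) : Prop where
  isCompact : ∀ x, IsCompact (Φ x)
  nonempty : ∀ x, (Φ x).Nonempty
  measurableSet_hit : ∀ F, IsClosed F → MeasurableSet {x | (Φ x ∩ F).Nonempty}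

/-- The set of minimizers of `f` over `s`. -/
def argminOn {Y : Type*} (s : Set Y) (f : Y → ℝ) : Set Y := {y ∈ s | IsMinOn f s y}

/-- The minimizers of `f x` over compact sets `Φ x` form a multifunction with measurable hit sets as
soon as the sets of those `x` are measurable for which `f x` takes a value at most `t` on
`Φ x ∩ F`. -/
theorem CompactMultifunction.argmin {X Y : Type*} [MeasurableSpace X] [TopologicalSpace Y]
    {Φ : X → Set Y} {f : X → Y → ℝ} (hc : ∀ x, IsCompact (Φ x)) (hne : ∀ x, (Φ x).Nonempty)
    (hf : ∀ x, LowerSemicontinuousOn (f x) (Φ x))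
    (hm : ∀ F, IsClosed F → ∀ t : ℝ, MeasurableSet {x | ∃ y ∈ Φ x ∩ F, f x y ≤ t}) :
    CompactMultifunction fun x => argminOn (Φ x) (f x) := by
  have hmin : ∀ x, ∃ y ∈ Φ x, IsMinOn (f x) (Φ x) y := fun x =>
    (hf x).exists_isMinOn (hne x) (hc x)
  refine ⟨fun x => ?_, fun x => ?_, fun F hF => ?_⟩
  · obtain ⟨y₀, hy₀, hy₀m⟩ := hmin x
    have : argminOn (Φ x) (f x) = Φ x ∩ f x ⁻¹' Set.Iic (f x y₀) := by
      ext y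
      refine ⟨fun h => ⟨h.1, h.2 hy₀⟩, fun h => ⟨h.1, fun z hz => ?_⟩⟩
      exact le_trans (b := f x y₀) h.2 (hy₀m hz)
    rw [this]
    exact (hf x).isCompact_inter_preimage_Iic (hc x) _
  · obtain ⟨y, hy, hym⟩ := hmin x
    exact ⟨y, hy, hym⟩
  · -- some minimizer lies in `F` iff the minimum over `F` does not exceed the minimum, which is
    -- tested at rational levels
    have : {x | (argminOn (Φ x) (f x) ∩ F).Nonempty} = ⋂ t : ℚ,
        ({x | ∃ y ∈ Φ x ∩ Set.univ, f x y ≤ t}ᶜ ∪ {x | ∃ y ∈ Φ x ∩ F, f x y ≤ t}) := by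
      ext x
      simp only [Set.mem_iInter, Set.mem_union, Set.mem_compl_iff, Set.mem_ofPred_eq,
        ← imp_iff_not_or]
      constructor
      · rintro ⟨y, ⟨hy, hym⟩, hyF⟩ t ⟨z, hz, hzt⟩
        exact ⟨y, ⟨hy, hyF⟩, le_trans (hym hz.1) hzt⟩
      · intro h
        obtain ⟨y₀, hy₀, hy₀m⟩ := hmin x
        obtain ⟨t, ht, -⟩ := exists_rat_btwn (lt_add_one (f x y₀))
        obtain ⟨y₁, hy₁, -⟩ := h t ⟨y₀, ⟨hy₀, trivial⟩, ht.le⟩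
        obtain ⟨y, hy, hym⟩ := ((hf x).mono Set.inter_subset_left).exists_isMinOn ⟨y₁, hy₁⟩
          ((hc x).inter_right hF)
        refine ⟨y, ⟨hy.1, fun z hz => ?_⟩, hy.2⟩
        refine le_trans (b := f x y₀) ?_ (hy₀m hz)
        by_contra hlt
        obtain ⟨s, hs, hs'⟩ := exists_rat_btwn (not_le.mp hlt)
        obtain ⟨w, hw, hws⟩ := h s ⟨y₀, ⟨hy₀, trivial⟩, hs.le⟩
        exact absurd (le_trans (hym hw) hws) (not_le.mpr hs')
    rw [this]
    exact MeasurableSet.iInter fun t => (hm _ isClosed_univ _).compl.union (hm F hF _)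

/-- A compact-valued multifunction has a measurable selector, if countably many continuous functions
separate the points: minimizing them successively leaves exactly one point. -/
theorem CompactMultifunction.exists_selector {X Y : Type*} [MeasurableSpace X]
    [TopologicalSpace Y] [T2Space Y] [MeasurableSpace Y] [BorelSpace Y] {Φ : X → Set Y}
    (hΦ : CompactMultifunction Φ) (u : ℕ → Y → ℝ) (hu : ∀ i, Continuous (u i))
    (hsep : ∀ y z, (∀ i, u i y = u i z) → y = z) :
    ∃ d : X → Y, Measurable d ∧ ∀ x, d x ∈ Φ x := by
  let Ψ : ℕ → X → Set Y := fun n =>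
    Nat.rec Φ (fun i Θ x => argminOn (Θ x) (u i)) n
  have hs : ∀ n x, Ψ (n + 1) x = argminOn (Ψ n x) (u n) := fun n x => rfl
  have hΨ : ∀ n, CompactMultifunction (Ψ n) := by
    intro n
    induction n with
    | zero => exact hΦ
    | succ n ih =>
      refine CompactMultifunction.argmin ih.isCompact ih.nonempty
        (fun x => (hu n).lowerSemicontinuous.lowerSemicontinuousOn _) fun F hF t => ?_
      convert ih.measurableSet_hit (F ∩ u n ⁻¹' Set.Iic t)
        (hF.inter (isClosed_Iic.preimage (hu n))) using 1
      ext x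
      constructor
      · rintro ⟨y, hy, hyt⟩
        exact ⟨y, hy.1, hy.2, hyt⟩
      · rintro ⟨y, hy, hyF, hyt⟩
        exact ⟨y, ⟨hy, hyF⟩, hyt⟩
  have hdec : ∀ n x, Ψ (n + 1) x ⊆ Ψ n x := fun n x y hy => hy.1
  have hint : ∀ F, IsClosed F → ∀ x, (∀ n, (Ψ n x ∩ F).Nonempty) →
      ((⋂ n, Ψ n x) ∩ F).Nonempty := by
    intro F hF x h
    rw [Set.iInter_inter]
    exact IsCompact.nonempty_iInter_of_sequence_nonempty_isCompact_isClosed _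
      (fun n => Set.inter_subset_inter_left _ (hdec n x)) h
      (((hΨ 0).isCompact x).inter_right hF) fun n => ((hΨ n).isCompact x).isClosed.inter hF
  have hne : ∀ x, ∃ y, ∀ n, y ∈ Ψ n x := by
    intro x
    obtain ⟨y, hy, -⟩ := hint Set.univ isClosed_univ x fun n => by
      simpa using (hΨ n).nonempty x
    exact ⟨y, Set.mem_iInter.mp hy⟩
  choose d hd using hne
  have huniq : ∀ x y, (∀ n, y ∈ Ψ n x) → y = d x := fun x y hy => hsep _ _ fun i =>
    le_antisymm ((hs i x ▸ hy (i + 1)).2 (hd x i)) ((hs i x ▸ hd x (i + 1)).2 (hy i))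
  refine ⟨d, measurable_of_isClosed fun F hF => ?_, fun x => hd x 0⟩
  have : d ⁻¹' F = ⋂ n, {x | (Ψ n x ∩ F).Nonempty} := by
    ext x
    simp only [Set.mem_preimage, Set.mem_iInter, Set.mem_ofPred_eq]
    refine ⟨fun h n => ⟨d x, hd x n, h⟩, fun h => ?_⟩
    obtain ⟨y, hy, hyF⟩ := hint F hF x h
    rwa [← huniq x y (Set.mem_iInter.mp hy)]
  rw [this]
  exact MeasurableSet.iInter fun n => (hΨ n).measurableSet_hit F hF

/-! ### The dual of `L^p` -/

section Dual

variable {Z : Type*} [MeasurableSpace Z] {μ : Measure Z} {p q : ℝ≥0∞} [p.HolderConjugate q]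

theorem integrable_mul_Lp (f : Lp ℝ q μ) (g : Lp ℝ p μ) : Integrable (fun z => f z * g z) μ :=
  memLp_one_iff_integrable.mp ((Lp.memLp g).mul (Lp.memLp f))

theorem lpPairing_mul_apply [Fact (1 ≤ p)] [Fact (1 ≤ q)] (f : Lp ℝ q μ) (g : Lp ℝ p μ) :
    (ContinuousLinearMap.mul ℝ ℝ).lpPairing μ q p f g = ∫ z, f z * g z ∂μ := by
  rw [ContinuousLinearMap.lpPairing_eq_integral]
  rfl

/-- A continuous linear functional `φ` on `L^p` of a finite measure is given on indicators by an
integrable function, the density of the signed measure `B ↦ φ(1_B)`. -/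
theorem exists_integrable_forall_indicatorConstLp [IsFiniteMeasure μ] [Fact (1 ≤ p)] (hp : p ≠ ∞)
    (φ : StrongDual ℝ (Lp ℝ p μ)) :
    ∃ h : Z → ℝ, Measurable h ∧ Integrable h μ ∧ ∀ (B : Set Z) (hB : MeasurableSet B),
      ∫ z in B, h z ∂μ = φ (indicatorConstLp p hB (measure_ne_top μ B) 1) := by
  classical
  let ν : SignedMeasure Z :=
    { measureOf' := fun B =>
        if hB : MeasurableSet B then φ (indicatorConstLp p hB (measure_ne_top μ B) 1) else 0
      empty' := by simp
      not_measurable' := fun B hB => by simp [hB]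
      m_iUnion' := by
        intro B hB hd
        simp only [hB, MeasurableSet.iUnion hB, dite_true]
        refine φ.hasSum ?_
        have hfin : ∀ s : Finset ℕ, MeasurableSet (⋃ i ∈ s, B i) := fun s =>
          s.measurableSet_biUnion fun i _ => hB i
        have hsum : ∀ s : Finset ℕ,
            ∑ i ∈ s, indicatorConstLp p (hB i) (measure_ne_top μ (B i)) (1 : ℝ) =
              indicatorConstLp p (hfin s) (measure_ne_top μ _) 1 := by
          intro s
          induction s using Finset.induction_on with
          | empty => simp
          | insert i s hi ih =>
            rw [Finset.sum_insert hi, ih]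
            have hdis : Disjoint (B i) (⋃ j ∈ s, B j) := by
              refine Set.disjoint_iUnion₂_right.mpr fun j hj => hd ?_
              rintro rfl
              exact hi hj
            rw [← indicatorConstLp_disjoint_union (hB i) (hfin s) _ _ hdis]
            simp only [Finset.set_biUnion_insert]
        unfold HasSum
        simp only [hsum]
        -- the finite unions approximate the whole union in measure, hence in `L^p`, as `p < ∞`
        refine tendsto_indicatorConstLp_set hp ?_
        have hanti : Antitone fun s : Finset ℕ => (⋃ i, B i) \ ⋃ i ∈ s, B i := fun s t hst =>
          Set.sdiff_subset_sdiff_right (Set.biUnion_subset_biUnion_left hst)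
        have hlim := tendsto_measure_iInter_atTop (μ := μ)
          (fun s => ((MeasurableSet.iUnion hB).diff (hfin s)).nullMeasurableSet) hanti
          ⟨∅, measure_ne_top _ _⟩
        have hempty : ⋂ s : Finset ℕ, ((⋃ i, B i) \ ⋃ i ∈ s, B i) = ∅ := by
          refine Set.eq_empty_of_forall_notMem fun z hz => ?_
          rw [Set.mem_iInter] at hz
          obtain ⟨i, hi⟩ := Set.mem_iUnion.mp (hz ∅).1
          exact (hz {i}).2 (by simpa using hi)
        rw [hempty, measure_empty] at hlim
        refine hlim.congr fun s => ?_
        simp only [Function.comp_apply]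
        rw [Set.symmDiff_def, Set.sdiff_eq_empty.mpr (Set.iUnion₂_subset_iUnion _ _),
          Set.empty_union] }
  have hν : ∀ (B : Set Z) (hB : MeasurableSet B),
      ν B = φ (indicatorConstLp p hB (measure_ne_top μ B) 1) := fun B hB => dif_pos hB
  have hac : ν ≪ᵥ μ.toENNRealVectorMeasure := by
    refine VectorMeasure.AbsolutelyContinuous.mk fun B hB h0 => ?_
    rw [Measure.toENNRealVectorMeasure_apply_measurable hB] at h0
    rw [hν B hB]
    have : indicatorConstLp p hB (measure_ne_top μ B) (1 : ℝ) = 0 := by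
      rw [Lp.eq_zero_iff_ae_eq_zero]
      filter_upwards [indicatorConstLp_coeFn (p := p) (hs := hB) (hμs := measure_ne_top μ B)
        (c := (1 : ℝ)), measure_eq_zero_iff_ae_notMem.mp h0] with z hz hzB
      simp [hz, hzB]
    rw [this, map_zero]
  refine ⟨ν.rnDeriv μ, SignedMeasure.measurable_rnDeriv _ _, SignedMeasure.integrable_rnDeriv _ _,
    fun B hB => ?_⟩
  rw [← hν B hB, ← withDensityᵥ_apply (SignedMeasure.integrable_rnDeriv _ _) hB,
    (SignedMeasure.absolutelyContinuous_iff_withDensityᵥ_rnDeriv_eq ν μ).mp hac]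

/-- Two continuous linear functionals on `L^p`, `p < ∞`, that agree on indicators are equal. -/
theorem strongDual_Lp_ext [IsFiniteMeasure μ] [Fact (1 ≤ p)] (hp : p ≠ ∞)
    {φ ψ : StrongDual ℝ (Lp ℝ p μ)}
    (h : ∀ (B : Set Z) (hB : MeasurableSet B),
      φ (indicatorConstLp p hB (measure_ne_top μ B) 1) =
        ψ (indicatorConstLp p hB (measure_ne_top μ B) 1)) : φ = ψ := by
  ext g
  refine Lp.induction hp (fun g => φ g = ψ g) (fun c B hB hμB => ?_) (fun f g hf hg _ h1 h2 => ?_)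
    (isClosed_eq φ.continuous ψ.continuous) g
  · have : indicatorConstLp p hB (measure_ne_top μ B) c =
        c • indicatorConstLp p hB (measure_ne_top μ B) (1 : ℝ) := by
      rw [indicatorConstLp, indicatorConstLp, ← MemLp.toLp_const_smul]
      congr 1
      ext z
      by_cases hz : z ∈ B <;> simp [hz]
    rw [Lp.simpleFunc.coe_indicatorConst, this, map_smul, map_smul, h B hB]
  · rw [map_add, map_add, h1, h2]

/-- The converse of Hölder's inequality for a bounded function `f`: test against
`g = sign f |f|^(q - 1)` if `q < ∞`, and against indicators if `q = ∞`. -/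
theorem eLpNorm_le_of_forall_integral_le [IsFiniteMeasure μ] [Fact (1 ≤ p)] [Fact (1 ≤ q)]
    (hp : p ≠ ∞) {f : Z → ℝ} (hf : Measurable f) {m : ℝ} (hm : ∀ z, |f z| ≤ m) {C : ℝ}
    (hC0 : 0 ≤ C) (hC : ∀ (g : Z → ℝ) (hg : MemLp g p μ), ∫ z, f z * g z ∂μ ≤ C * ‖hg.toLp g‖) :
    eLpNorm f q μ ≤ ENNReal.ofReal C := by
  have hp0 : p ≠ 0 := ENNReal.HolderConjugate.ne_zero p q
  have hfi : Integrable f μ := .of_bound hf.aestronglyMeasurable m (ae_of_all _ hm)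
  by_cases hq : q = ∞
  · obtain rfl : p = 1 := (ENNReal.HolderConjugate.eq_top_iff_eq_one q p).mp hq
    subst hq
    have key : ∀ s : ℝ, |s| = 1 → ∀ B, MeasurableSet B →
        ∫ z in B, s * f z ∂μ ≤ ∫ z in B, C ∂μ := by
      intro s hs B hB
      have hg : MemLp (B.indicator fun _ => s) 1 μ :=
        memLp_indicator_const _ hB _ (Or.inr (measure_ne_top _ _))
      have h1 := hC _ hg
      have h2 : ∫ z, f z * B.indicator (fun _ => s) z ∂μ = ∫ z in B, s * f z ∂μ := by
        rw [← integral_indicator hB]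
        congr 1
        ext z
        by_cases hz : z ∈ B <;> simp [hz, mul_comm]
      have h3 : ‖hg.toLp _‖ = μ.real B := by
        have := norm_indicatorConstLp (p := 1) (hs := hB) (hμs := measure_ne_top μ B) (c := s)
          one_ne_zero ENNReal.one_ne_top
        rw [indicatorConstLp] at this
        rw [this]
        simp [hs]
      rw [h2, h3] at h1
      simpa [mul_comm] using h1
    have hle : ∀ s : ℝ, |s| = 1 → ∀ᵐ z ∂μ, s * f z ≤ C := fun s hs =>
      ae_le_of_forall_setIntegral_le (hfi.const_mul s) (integrable_const C)
        fun B hB _ => key s hs B hB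
    rw [eLpNorm_exponent_top]
    refine eLpNormEssSup_le_of_ae_bound ?_
    filter_upwards [hle 1 (by simp), hle (-1) (by simp)] with z h1 h2
    rw [Real.norm_eq_abs, abs_le]
    constructor <;> linarith
  · have hpq : p.toReal.HolderConjugate q.toReal := by
      have hp1 : p ≠ 1 := (ENNReal.HolderConjugate.ne_top_iff_ne_one q p).mp hq
      have h1 : 1 < p := lt_of_le_of_ne (ENNReal.HolderConjugate.one_le p q) (Ne.symm hp1)
      rw [Real.holderConjugate_iff]
      refine ⟨by simpa using (ENNReal.toReal_lt_toReal ENNReal.one_ne_top hp).mpr h1, ?_⟩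
      have h2 := ENNReal.HolderConjugate.inv_add_inv_eq_one p q
      rw [← ENNReal.toReal_inv, ← ENNReal.toReal_inv, ← ENNReal.toReal_add, h2]
      · simp
      · simpa using hp0
      · simpa using ENNReal.HolderConjugate.ne_zero q p
    set r := q.toReal with hr
    have hr1 : 1 < r := hpq.symm.lt
    let g : Z → ℝ := fun z => SignType.sign (f z) * |f z| ^ (r - 1)
    have hgm : Measurable g := by
      have : Measurable fun z => ((SignType.sign (f z) : ℝ)) := by
        have h1 : Measurable fun t : ℝ => ((SignType.sign t : SignType) : ℝ) := by
          simp only [sign_apply]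
          refine Measurable.comp (g := fun s : SignType => (s : ℝ)) measurable_from_top ?_
          exact Measurable.ite measurableSet_Ioi measurable_const
            (Measurable.ite measurableSet_Iio measurable_const measurable_const)
        exact h1.comp hf
      exact this.mul (hf.abs.pow_const _)
    have hgn : ∀ z, |g z| = |f z| ^ (r - 1) := by
      intro z
      rcases lt_trichotomy (f z) 0 with h | h | h
      · simp [g, sign_neg h, abs_of_nonneg (Real.rpow_nonneg (abs_nonneg (f z)) _)]
      · simp [g, h, Real.zero_rpow (by linarith : r - 1 ≠ 0)]
      · simp [g, sign_pos h, abs_of_nonneg (Real.rpow_nonneg (abs_nonneg (f z)) _)]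
    have hfg : ∀ z, f z * g z = |f z| ^ r := by
      intro z
      have h1 : f z * g z = |f z| * |f z| ^ (r - 1) := by
        simp only [g, ← mul_assoc, self_mul_sign]
      rw [h1]
      rcases eq_or_ne (f z) 0 with h | h
      · simp [h, Real.zero_rpow (by linarith : r ≠ 0)]
      · rw [← Real.rpow_one_add' (abs_nonneg _) (by linarith)]
        congr 1
        ring
    have hg : MemLp g p μ := by
      refine MemLp.of_bound hgm.aestronglyMeasurable (m ^ (r - 1)) (ae_of_all _ fun z => ?_)
      rw [Real.norm_eq_abs, hgn]
      exact Real.rpow_le_rpow (abs_nonneg _) (hm z) (by linarith)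
    have hgp : ∀ z, ‖g z‖ ^ p.toReal = |f z| ^ r := by
      intro z
      rw [Real.norm_eq_abs, hgn, ← Real.rpow_mul (abs_nonneg _), hpq.symm.sub_one_mul_conj]
    have h1 := hC g hg
    set I := ∫ z, |f z| ^ r ∂μ with hI
    have hI0 : 0 ≤ I := integral_nonneg fun z => Real.rpow_nonneg (abs_nonneg _) _
    have hgnorm : ‖hg.toLp g‖ = I ^ (1 / p.toReal) := by
      rw [Lp.norm_toLp, hg.eLpNorm_eq_integral_rpow_norm hp0 hp, ENNReal.toReal_ofReal]
      · simp only [hgp, one_div]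
        rfl
      · refine Real.rpow_nonneg (integral_nonneg fun z => Real.rpow_nonneg (norm_nonneg _) _) _
    simp only [hfg] at h1
    rw [hgnorm] at h1
    have hfq : MemLp f q μ := MemLp.of_bound hf.aestronglyMeasurable m (ae_of_all _ hm)
    rw [hfq.eLpNorm_eq_integral_rpow_norm (ENNReal.HolderConjugate.ne_zero q p) hq]
    refine ENNReal.ofReal_le_ofReal ?_
    change I ^ r⁻¹ ≤ C
    have hexp : 1 / p.toReal + r⁻¹ = 1 := by
      have := hpq.inv_add_inv_eq_one
      rwa [← one_div p.toReal] at this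
    rcases hI0.eq_or_lt with h0 | h0
    · rwa [← h0, Real.zero_rpow (by positivity)]
    · have h2 : 0 < I ^ (1 / p.toReal) := Real.rpow_pos_of_pos h0 _
      have h3 : I ^ (1 / p.toReal) * I ^ r⁻¹ = I := by
        rw [← Real.rpow_add h0, hexp, Real.rpow_one]
      refine le_of_mul_le_mul_left ?_ h2
      rw [h3, mul_comm]
      exact h1

/-- Riesz representation: every continuous linear functional on `L^p`, `p < ∞`, of a finite measure
is the integral against a function of `L^q`. The density of `B ↦ φ(1_B)` lies in `L^q` because its
truncations are bounded in `L^q` by `‖φ‖`. -/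
theorem exists_Lp_forall_eq_integral [IsFiniteMeasure μ] [Fact (1 ≤ p)] [Fact (1 ≤ q)] (hp : p ≠ ∞)
    (φ : StrongDual ℝ (Lp ℝ p μ)) : ∃ f : Lp ℝ q μ, ∀ g, φ g = ∫ z, f z * g z ∂μ := by
  obtain ⟨h, hm, -, hφ⟩ := exists_integrable_forall_indicatorConstLp hp φ
  let S : ℕ → Set Z := fun n => {z | |h z| ≤ n}
  have hS : ∀ n, MeasurableSet (S n) := fun n => measurableSet_le hm.abs measurable_const
  let hn : ℕ → Z → ℝ := fun n => (S n).indicator h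
  have hnm : ∀ n, Measurable (hn n) := fun n => hm.indicator (hS n)
  have hnb : ∀ n z, |hn n z| ≤ n := by
    intro n z
    by_cases hz : z ∈ S n
    · have h1 : |h z| ≤ n := hz
      simpa [hn, hz] using h1
    · simp [hn, hz]
  have hnLp : ∀ n, MemLp (hn n) q μ := fun n =>
    MemLp.of_bound (hnm n).aestronglyMeasurable n (ae_of_all _ (hnb n))
  have hbd : ∀ n, eLpNorm (hn n) q μ ≤ ENNReal.ofReal ‖φ‖ := by
    intro n
    refine eLpNorm_le_of_forall_integral_le (p := p) hp (hnm n) (hnb n) (norm_nonneg φ) ?_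
    -- multiplication by the indicator of `S n`, as an operator on `L^p`
    let e : Lp ℝ ∞ μ := indicatorConstLp ∞ (hS n) (measure_ne_top μ _) 1
    let R : Lp ℝ p μ →L[ℝ] Lp ℝ p μ := (ContinuousLinearMap.mul ℝ ℝ).holderL μ ∞ p p e
    have hR : φ.comp R =
        (ContinuousLinearMap.mul ℝ ℝ).lpPairing μ q p ((hnLp n).toLp) := by
      refine strongDual_Lp_ext hp fun B hB => ?_
      have h1 : R (indicatorConstLp p hB (measure_ne_top μ B) 1) =
          indicatorConstLp p ((hS n).inter hB) (measure_ne_top μ _) 1 := by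
        refine Lp.ext ?_
        filter_upwards [(ContinuousLinearMap.mul ℝ ℝ).coeFn_holder (r := p) e
            (indicatorConstLp p hB (measure_ne_top μ B) 1),
          indicatorConstLp_coeFn (p := p) (hs := hB) (hμs := measure_ne_top μ B) (c := (1 : ℝ)),
          indicatorConstLp_coeFn (p := ∞) (hs := hS n) (hμs := measure_ne_top μ _) (c := (1 : ℝ)),
          indicatorConstLp_coeFn (p := p) (hs := (hS n).inter hB) (hμs := measure_ne_top μ _)
            (c := (1 : ℝ))] with z h2 h3 h4 h5
        change ((ContinuousLinearMap.mul ℝ ℝ).holder p e _ : Lp ℝ p μ) z = _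
        rw [h2, h3, h5, ContinuousLinearMap.mul_apply']
        change (e z) * _ = _
        rw [h4]
        by_cases hz : z ∈ S n <;> by_cases hz' : z ∈ B <;> simp [hz, hz']
      rw [ContinuousLinearMap.comp_apply, h1, ← hφ _ ((hS n).inter hB), lpPairing_mul_apply,
        ← integral_indicator ((hS n).inter hB)]
      refine integral_congr_ae ?_
      filter_upwards [(hnLp n).coeFn_toLp,
        indicatorConstLp_coeFn (p := p) (hs := hB) (hμs := measure_ne_top μ B) (c := (1 : ℝ))]
        with z h2 h3
      rw [h2, h3]
      by_cases hz : z ∈ S n <;> by_cases hz' : z ∈ B <;> simp [hn, hz, hz']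
    intro g hg
    have h1 : ∫ z, hn n z * g z ∂μ = φ (R hg.toLp) := by
      rw [← ContinuousLinearMap.comp_apply, hR, lpPairing_mul_apply]
      refine integral_congr_ae ?_
      filter_upwards [(hnLp n).coeFn_toLp, hg.coeFn_toLp] with z h2 h3
      rw [h2, h3]
    have h2 : ‖R hg.toLp‖ ≤ ‖hg.toLp‖ := by
      refine ((ContinuousLinearMap.mul ℝ ℝ).norm_holder_apply_apply_le e hg.toLp).trans ?_
      have h3 : ‖e‖ ≤ 1 := by
        have := norm_indicatorConstLp_le (p := ∞) (hs := hS n) (hμs := measure_ne_top μ _)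
          (c := (1 : ℝ))
        simpa using this
      have h4 : ‖ContinuousLinearMap.mul ℝ ℝ‖ ≤ 1 := ContinuousLinearMap.opNorm_mul_le ℝ ℝ
      calc _ ≤ 1 * 1 * ‖hg.toLp‖ := by gcongr
        _ = _ := by ring
    rw [h1]
    calc φ (R hg.toLp) ≤ ‖φ (R hg.toLp)‖ := le_abs_self _
      _ ≤ ‖φ‖ * ‖R hg.toLp‖ := φ.le_opNorm _
      _ ≤ _ := by gcongr
  have hlim : ∀ z, Tendsto (fun n => hn n z) atTop (𝓝 (h z)) := by
    intro z
    refine tendsto_const_nhds.congr' ?_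
    filter_upwards [eventually_ge_atTop ⌈|h z|⌉₊] with n hz
    have : z ∈ S n := Nat.ceil_le.mp hz
    simp [hn, this]
  have hq : MemLp h q μ := by
    refine ⟨hm.aestronglyMeasurable, lt_of_le_of_lt
      (Lp.eLpNorm_lim_le_liminf_eLpNorm (fun n => (hnm n).aestronglyMeasurable) h
        (ae_of_all _ hlim)) (lt_of_le_of_lt ?_ (ENNReal.ofReal_lt_top (r := ‖φ‖)))⟩
    exact liminf_le_of_frequently_le' (Frequently.of_forall hbd)
  refine ⟨hq.toLp, fun g => ?_⟩
  rw [← lpPairing_mul_apply]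
  refine DFunLike.congr_fun (strongDual_Lp_ext hp fun B hB => ?_) g
  rw [← hφ B hB, lpPairing_mul_apply, ← integral_indicator hB]
  refine integral_congr_ae ?_
  filter_upwards [hq.coeFn_toLp,
    indicatorConstLp_coeFn (p := p) (hs := hB) (hμs := measure_ne_top μ B) (c := (1 : ℝ))]
    with z h2 h3
  rw [h2, h3]
  by_cases hz' : z ∈ B <;> simp [hz']

end Dual

/-! ### The weak* topology on the ambiguity sets -/

/-- The topology of pointwise convergence of a family of uniformly Lipschitz functions is already
induced by the evaluations at a dense sequence. -/
theorem induced_eval_eq_induced_denseSeq {X V : Type*} [PseudoMetricSpace V]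
    [TopologicalSpace.SeparableSpace V] [Nonempty V] (ι : X → V → ℝ) {C : ℝ}
    (hC : ∀ x g g', |ι x g - ι x g'| ≤ C * dist g g') :
    TopologicalSpace.induced ι inferInstance =
      TopologicalSpace.induced (fun x (i : ℕ) => ι x (TopologicalSpace.denseSeq V i))
        inferInstance := by
  refine le_antisymm ?_ ?_
  · let := TopologicalSpace.induced ι inferInstance
    rw [← continuous_iff_le_induced]
    exact continuous_pi fun i => (continuous_apply _).comp continuous_induced_dom
  · let := TopologicalSpace.induced
      (fun x (i : ℕ) => ι x (TopologicalSpace.denseSeq V i)) inferInstance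
    rw [← continuous_iff_le_induced]
    have hcont : Continuous fun x (i : ℕ) => ι x (TopologicalSpace.denseSeq V i) :=
      continuous_induced_dom
    refine continuous_pi fun g => continuous_of_uniform_approx_of_continuous fun u hu => ?_
    obtain ⟨ε, hε, hεu⟩ := Metric.mem_uniformity_dist.mp hu
    have hC1 : 0 < |C| + 1 := by positivity
    obtain ⟨i, hi⟩ := (TopologicalSpace.denseRange_denseSeq V).exists_dist_lt g
      (div_pos hε hC1)
    refine ⟨fun x => ι x (TopologicalSpace.denseSeq V i),
      continuous_pi_iff.mp hcont i, fun x => hεu ?_⟩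
    rw [Real.dist_eq]
    calc _ ≤ C * dist g _ := hC x _ _
      _ ≤ (|C| + 1) * dist g _ := by
        gcongr
        linarith [le_abs_self C]
      _ < _ := by rwa [lt_div_iff₀' hC1] at hi

namespace RobustMDP

variable {N : ℕ} {E A Z : Type*} [MeasurableSpace E] [MeasurableSpace A] [MeasurableSpace Z]
  (M : RobustMDP N E A Z)

instance (k : Fin N) : IsProbabilityMeasure (M.P k) := M.isProbabilityMeasure_P k

instance (k : Fin N) : MeasureTheory.IsSeparable (M.P k) := M.isSeparable_P k

instance : M.p.HolderConjugate M.q := M.holderConjugate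

instance : Fact (1 ≤ M.p) := ⟨ENNReal.HolderConjugate.one_le M.p M.q⟩

instance : Fact (1 ≤ M.q) := ⟨ENNReal.HolderConjugate.one_le M.q M.p⟩

instance : Fact (M.p ≠ ∞) := ⟨((ENNReal.HolderConjugate.lt_top_iff_one_lt M.p M.q).mpr M.one_lt_q).ne⟩

instance (k : Fin N) : BorelSpace (M.Amb k) := ⟨rfl⟩

instance (k : Fin N) : Nonempty (M.Amb k) :=
  let ⟨Q, hQ⟩ := M.ambiguity_nonempty k
  ⟨⟨Q, hQ⟩⟩

variable {M}

/-- The evaluation of the density of `Q` at `g ∈ L^p`. -/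
def Amb.pairing {k : Fin N} (Q : M.Amb k) (g : Lp ℝ M.p (M.P k)) : ℝ :=
  ∫ z, Q.density z * g z ∂(M.P k)

theorem Amb.topology_eq (k : Fin N) :
    (inferInstance : TopologicalSpace (M.Amb k)) =
      TopologicalSpace.induced (Amb.pairing : M.Amb k → _) inferInstance :=
  induced_compose
    (g := fun (f : Lp ℝ M.q (M.P k)) (g : Lp ℝ M.p (M.P k)) => ∫ z, f z * g z ∂(M.P k))
    (f := (Amb.density : M.Amb k → _))

theorem Amb.continuous_pairing {k : Fin N} (g : Lp ℝ M.p (M.P k)) :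
    Continuous fun Q : M.Amb k => Q.pairing g :=
  (continuous_apply g).comp (continuous_iff_le_induced.mpr (Amb.topology_eq k).le)

theorem Amb.pairing_eq_lpPairing {k : Fin N} (Q : M.Amb k) (g : Lp ℝ M.p (M.P k)) :
    Q.pairing g = (ContinuousLinearMap.mul ℝ ℝ).lpPairing (M.P k) M.q M.p Q.density g :=
  (lpPairing_mul_apply _ _).symm

theorem Amb.coeFn_density {k : Fin N} (Q : M.Amb k) :
    Q.density =ᵐ[M.P k] fun z => (Q.measure.rnDeriv (M.P k) z).toReal :=
  (M.memLp_ambiguity k Q.measure Q.mem).coeFn_toLp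

theorem Amb.integrable {k : Fin N} (Q : M.Amb k) {f : Z → ℝ} (hf : MemLp f M.p (M.P k)) :
    Integrable f Q.measure := by
  rw [← integrable_rnDeriv_smul_iff (M.absolutelyContinuous_ambiguity k Q.measure Q.mem)]
  refine (integrable_mul_Lp Q.density hf.toLp).congr ?_
  filter_upwards [Q.coeFn_density, hf.coeFn_toLp] with z h1 h2
  rw [h1, h2, smul_eq_mul]

theorem Amb.integral_eq_pairing {k : Fin N} (Q : M.Amb k) {f : Z → ℝ}
    (hf : MemLp f M.p (M.P k)) : ∫ z, f z ∂Q.measure = Q.pairing hf.toLp := by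
  rw [← integral_rnDeriv_smul (M.absolutelyContinuous_ambiguity k Q.measure Q.mem)]
  refine integral_congr_ae ?_
  filter_upwards [Q.coeFn_density, hf.coeFn_toLp] with z h1 h2
  rw [h1, h2, smul_eq_mul]

theorem Amb.continuous_integral {k : Fin N} {f : Z → ℝ} (hf : MemLp f M.p (M.P k)) :
    Continuous fun Q : M.Amb k => ∫ z, f z ∂Q.measure := by
  simp only [Amb.integral_eq_pairing _ hf]
  exact Amb.continuous_pairing _

theorem Amb.ext_pairing {k : Fin N} {Q Q' : M.Amb k} (h : ∀ g, Q.pairing g = Q'.pairing g) :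
    Q = Q' := by
  have : Q.measure = Q'.measure := by
    refine Measure.ext fun B hB => ?_
    have hB' : MemLp (B.indicator fun _ => (1 : ℝ)) M.p (M.P k) :=
      memLp_indicator_const _ hB _ (Or.inr (measure_ne_top _ _))
    have h1 := h hB'.toLp
    rw [← Amb.integral_eq_pairing, ← Amb.integral_eq_pairing, integral_indicator_const _ hB,
      integral_indicator_const _ hB] at h1
    simpa [Measure.real, ENNReal.toReal_eq_toReal_iff'] using h1
  cases Q
  cases Q'
  simpa using this

/-- Norm-bounded densities act on `L^p` with a common Lipschitz constant. -/
theorem Amb.lipschitz_pairing {k : Fin N} {K : ℝ} (hK : ∀ Q : M.Amb k, ‖Q.density‖ ≤ K) :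
    ∃ C : ℝ, ∀ (Q : M.Amb k) (g g' : Lp ℝ M.p (M.P k)),
      |Q.pairing g - Q.pairing g'| ≤ C * dist g g' := by
  refine ⟨‖(ContinuousLinearMap.mul ℝ ℝ).lpPairing (M.P k) M.q M.p‖ * K, fun Q g g' => ?_⟩
  rw [Amb.pairing_eq_lpPairing, Amb.pairing_eq_lpPairing, ← map_sub, dist_eq_norm,
    ← Real.norm_eq_abs]
  refine (ContinuousLinearMap.le_opNorm₂ _ _ _).trans ?_
  gcongr
  exact hK Q

/-- On a norm-bounded ambiguity set the weak* topology is induced by the pairings with a dense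
sequence in `L^p`. -/
theorem Amb.isInducing_denseSeq {k : Fin N} {K : ℝ} (hK : ∀ Q : M.Amb k, ‖Q.density‖ ≤ K) :
    Topology.IsInducing fun (Q : M.Amb k) (i : ℕ) =>
      Q.pairing (TopologicalSpace.denseSeq (Lp ℝ M.p (M.P k)) i) := by
  obtain ⟨C, hC⟩ := Amb.lipschitz_pairing hK
  exact ⟨(Amb.topology_eq k).trans (induced_eval_eq_induced_denseSeq _ hC)⟩

theorem Amb.secondCountableTopology {k : Fin N} {K : ℝ} (hK : ∀ Q : M.Amb k, ‖Q.density‖ ≤ K) :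
    SecondCountableTopology (M.Amb k) :=
  (Amb.isInducing_denseSeq hK).secondCountableTopology

theorem Amb.eq_of_pairing_denseSeq {k : Fin N} {Q Q' : M.Amb k} (h : ∀ i : ℕ, Q.pairing (TopologicalSpace.denseSeq (Lp ℝ M.p (M.P k)) i) =
      Q'.pairing (TopologicalSpace.denseSeq (Lp ℝ M.p (M.P k)) i)) : Q = Q' := by
  refine Amb.ext_pairing fun g => ?_
  have hc : ∀ Q : M.Amb k, Continuous Q.pairing := fun Q => by
    have : Q.pairing = (ContinuousLinearMap.mul ℝ ℝ).lpPairing (M.P k) M.q M.p Q.density :=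
      funext Q.pairing_eq_lpPairing
    rw [this]
    exact ContinuousLinearMap.continuous _
  exact congrFun ((hc Q).ext_on (TopologicalSpace.denseRange_denseSeq _) (hc Q')
    (by rintro _ ⟨i, rfl⟩; exact h i)) g

theorem Amb.t2Space {k : Fin N} : T2Space (M.Amb k) := by
  refine T2Space.of_injective_continuous (f := (Amb.pairing : M.Amb k → _))
    (fun Q Q' h => Amb.ext_pairing fun g => congrFun h g)
    (continuous_pi fun g => Amb.continuous_pairing g)

/-- A norm-bounded, weak* closed ambiguity set is weak* compact (Banach--Alaoglu): an ultrafilter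
converges pointwise on `L^p` to a bounded linear functional, which a function of `L^q`
represents. -/
theorem Amb.compactSpace {k : Fin N} {K : ℝ} (hK : ∀ Q : M.Amb k, ‖Q.density‖ ≤ K)
    (hcl : M.WeakStarClosed k) : CompactSpace (M.Amb k) := by
  let B := (ContinuousLinearMap.mul ℝ ℝ).lpPairing (M.P k) M.q M.p
  have hbd : ∀ (Q : M.Amb k) g, ‖Q.pairing g‖ ≤ ‖B‖ * K * ‖g‖ := fun Q g => by
    rw [Amb.pairing_eq_lpPairing]
    refine (ContinuousLinearMap.le_opNorm₂ _ _ _).trans ?_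
    gcongr
    exact hK Q
  refine ⟨isCompact_iff_ultrafilter_le_nhds.mpr fun U _ => ?_⟩
  have hlim : ∀ g, ∃ t ∈ Metric.closedBall (0 : ℝ) (‖B‖ * K * ‖g‖),
      Tendsto (fun Q : M.Amb k => Q.pairing g) U (𝓝 t) := by
    intro g
    exact isCompact_iff_ultrafilter_le_nhds.mp (isCompact_closedBall (0 : ℝ) (‖B‖ * K * ‖g‖))
      (U.map fun Q : M.Amb k => Q.pairing g) (by
        rw [Filter.le_principal_iff]
        exact Filter.mem_map.mpr (Filter.univ_mem' fun Q => by
          simpa using hbd Q g))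
  choose φ hφ hφlim using hlim
  have hpa : ∀ (Q : M.Amb k) g g', Q.pairing (g + g') = Q.pairing g + Q.pairing g' := by
    simp [Amb.pairing_eq_lpPairing]
  have hps : ∀ (Q : M.Amb k) (r : ℝ) g, Q.pairing (r • g) = r * Q.pairing g := by
    simp [Amb.pairing_eq_lpPairing]
  let Φ : StrongDual ℝ (Lp ℝ M.p (M.P k)) := LinearMap.mkContinuous
    { toFun := φ
      map_add' := fun g g' => tendsto_nhds_unique (hφlim (g + g')) (by
        simpa only [hpa] using (hφlim g).add (hφlim g'))
      map_smul' := fun r g => tendsto_nhds_unique (hφlim (r • g)) (by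
        simpa only [hps, RingHom.id_apply, smul_eq_mul] using (hφlim g).const_mul r) } (‖B‖ * K)
    fun g => by simpa using hφ g
  obtain ⟨f, hf⟩ := exists_Lp_forall_eq_integral (q := M.q) (Fact.out : M.p ≠ ∞) Φ
  have hfU : ∀ g : Lp ℝ M.p (M.P k), Tendsto (fun Q : M.Amb k => ∫ z, Q.density z * g z ∂(M.P k)) U
      (𝓝 (∫ z, f z * g z ∂(M.P k))) := fun g => by
    rw [← hf g]
    exact hφlim g
  have hfr : f ∈ Set.range (Amb.density : M.Amb k → _) := by
    let := weakStarTopology (M.P k) M.p M.q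
    refine IsClosed.mem_of_tendsto (f := (Amb.density : M.Amb k → _)) (b := U) hcl ?_
      (Filter.univ_mem' fun Q => ⟨Q, rfl⟩)
    rw [nhds_induced, tendsto_comap_iff]
    exact tendsto_pi_nhds.mpr hfU
  obtain ⟨Q, rfl⟩ := hfr
  refine ⟨Q, trivial, ?_⟩
  have h1 : 𝓝 Q = Filter.comap (Amb.pairing : M.Amb k → _) (𝓝 Q.pairing) :=
    (congrArg (fun t => @nhds _ t Q) (Amb.topology_eq k)).trans (nhds_induced _ _)
  rw [h1, ← Filter.tendsto_iff_comap]
  exact tendsto_pi_nhds.mpr hfU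

end RobustMDP

/-! ### The operators `L_k` -/

theorem enorm_eq_ofReal_add_ofReal_neg (t : ℝ) :
    ‖t‖ₑ = ENNReal.ofReal t + ENNReal.ofReal (-t) := by
  rw [Real.enorm_eq_ofReal_abs]
  rcases le_total 0 t with h | h
  · rw [abs_of_nonneg h, ENNReal.ofReal_of_nonpos (neg_nonpos.mpr h), add_zero]
  · rw [abs_of_nonpos h, ENNReal.ofReal_of_nonpos h, zero_add]

theorem EReal.coe_ciSup {ι : Type*} [Nonempty ι] {f : ι → ℝ} (hf : BddAbove (Set.range f)) :
    ((⨆ i, f i : ℝ) : EReal) = ⨆ i, (f i : EReal) := by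
  refine le_antisymm ?_ (iSup_le fun i => EReal.coe_le_coe (le_ciSup hf i))
  refine le_of_forall_lt fun c hc => ?_
  obtain ⟨r, hcr, hr⟩ := EReal.lt_iff_exists_real_btwn.mp hc
  obtain ⟨i, hi⟩ := exists_lt_of_lt_ciSup (EReal.coe_lt_coe_iff.mp hr)
  exact (hcr.trans (EReal.coe_lt_coe_iff.mpr hi)).trans_le (le_iSup (fun i => (f i : EReal)) i)

/-- In a separable metrizable space, countably many continuous functions separate the points. -/
theorem exists_continuous_separating (Y : Type*) [TopologicalSpace Y]
    [TopologicalSpace.MetrizableSpace Y] [SecondCountableTopology Y] :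
    ∃ u : ℕ → Y → ℝ, (∀ i, Continuous (u i)) ∧ ∀ y z, (∀ i, u i y = u i z) → y = z := by
  let _ := TopologicalSpace.metrizableSpaceMetric Y
  rcases isEmpty_or_nonempty Y with h | h
  · exact ⟨fun _ _ => 0, fun i => continuous_const, fun y => h.elim y⟩
  · refine ⟨fun i y => dist y (TopologicalSpace.denseSeq Y i), fun i => by fun_prop,
      fun y z hyz => ?_⟩
    have h1 : (fun w => dist y w) = fun w => dist z w := by
      refine Continuous.ext_on (TopologicalSpace.denseRange_denseSeq Y) (by fun_prop)
        (by fun_prop) ?_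
      rintro _ ⟨i, rfl⟩
      exact hyz i
    have h2 := congrFun h1 z
    simpa using h2

namespace RobustMDP

variable {N : ℕ} {E A Z : Type*}
    [TopologicalSpace E] [TopologicalSpace.MetrizableSpace E] [SecondCountableTopology E]
    [MeasurableSpace E] [BorelSpace E]
    [TopologicalSpace A] [TopologicalSpace.MetrizableSpace A] [SecondCountableTopology A]
    [MeasurableSpace A] [BorelSpace A]
    [MeasurableSpace Z] {M : RobustMDP N E A Z}

theorem ContinuityCompactness.measurable_c (hM : M.ContinuityCompactness) (k : Fin N) :
    Measurable (M.c k) :=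
  (hM.lowerSemicontinuous_c k).measurable

theorem ContinuityCompactness.measurable_cT (hM : M.ContinuityCompactness) (k : Fin N) :
    Measurable fun r : M.D k × Z => M.c k (r.1, M.T k r) :=
  (hM.measurable_c k).comp (measurable_fst.prodMk (M.measurable_T k))

section Bounds

variable {α εl εu : ℝ} {bl bu : E → ℝ}

theorem Bounding.one_le (hb : M.Bounding α εl εu bl bu) (x : E) : 1 ≤ bu x - bl x := by
  linarith [hb.bl_le x, hb.le_bu x, hb.ε_add]

theorem Bounding.bl_nonpos (hb : M.Bounding α εl εu bl bu) (x : E) : bl x ≤ 0 := by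
  linarith [hb.bl_le x, hb.εl_nonneg]

theorem Bounding.bu_nonneg (hb : M.Bounding α εl εu bl bu) (x : E) : 0 ≤ bu x := by
  linarith [hb.le_bu x, hb.εu_nonneg]

theorem Bounding.ofReal_sub (hb : M.Bounding α εl εu bl bu) (x : E) :
    ENNReal.ofReal (bu x - bl x) = ENNReal.ofReal (bu x) + ENNReal.ofReal (-bl x) := by
  rw [sub_eq_add_neg, ENNReal.ofReal_add (hb.bu_nonneg x) (by linarith [hb.bl_nonpos x])]

theorem Bounding.lintegral_cost_le (hM : M.ContinuityCompactness)
    (hb : M.Bounding α εl εu bl bu) (k : Fin N) (Q : M.Amb k) (y : M.D k) :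
    ∫⁻ z, ‖M.c k (y, M.T k (y, z))‖ₑ ∂Q.measure ≤ ENNReal.ofReal (bu y.1.1 - bl y.1.1) := by
  have hm : Measurable fun z => M.c k (y, M.T k (y, z)) :=
    (hM.measurable_cT k).comp measurable_prodMk_left
  simp only [enorm_eq_ofReal_add_ofReal_neg]
  rw [lintegral_add_left hm.ennreal_ofReal, hb.ofReal_sub]
  exact add_le_add (hb.cost_upper k Q y) (hb.cost_lower k Q y)

theorem Bounding.lintegral_drift_le (hb : M.Bounding α εl εu bl bu) (k : Fin N) (Q : M.Amb k)
    (y : M.D k) :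
    ∫⁻ z, ENNReal.ofReal (bu (M.T k (y, z)) - bl (M.T k (y, z))) ∂Q.measure ≤
      ENNReal.ofReal α * ENNReal.ofReal (bu y.1.1 - bl y.1.1) := by
  have hm : Measurable fun z => bu (M.T k (y, z)) :=
    hb.measurable_bu.comp ((M.measurable_T k).comp measurable_prodMk_left)
  simp only [hb.ofReal_sub]
  rw [lintegral_add_left hm.ennreal_ofReal, mul_add, ← ENNReal.ofReal_mul hb.α_nonneg,
    ← ENNReal.ofReal_mul hb.α_nonneg, mul_neg]
  exact add_le_add (hb.drift_upper k Q y) (hb.drift_lower k Q y)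

theorem Bounding.exists_norm_density_le (hb : M.Bounding α εl εu bl bu) :
    ∃ K : ℝ, ∀ (k : Fin N) (Q : M.Amb k), ‖Q.density‖ ≤ K := by
  obtain ⟨K, hK1, hK⟩ := hb.norm_bound
  refine ⟨K, fun k Q => ?_⟩
  rw [Amb.density, Lp.norm_toLp]
  exact ENNReal.toReal_le_of_le_ofReal (by linarith) (hK k Q)

/-- The integrand `z ↦ c_k(x, a, x') + v(x')`, `x' = T_k(x, a, z)`, of `L_k v(x, a, ·)`. -/
def integrand (M : RobustMDP N E A Z) (k : Fin N) (v : E → ℝ) (y : M.D k) (z : Z) : ℝ :=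
  M.c k (y, M.T k (y, z)) + v (M.T k (y, z))

theorem ContinuityCompactness.measurable_integrand (hM : M.ContinuityCompactness) (k : Fin N)
    {v : E → ℝ} (hv : Measurable v) (y : M.D k) : Measurable (M.integrand k v y) :=
  ((hM.measurable_cT k).comp measurable_prodMk_left).add
    (hv.comp ((M.measurable_T k).comp measurable_prodMk_left))

theorem Bounding.lintegral_cost_add_drift_le (hM : M.ContinuityCompactness)
    (hb : M.Bounding α εl εu bl bu) (k : Fin N) {lam : ℝ} (hlam : 0 ≤ lam) (y : M.D k)
    (Q : M.Amb k) :
    ∫⁻ z, (‖M.c k (y, M.T k (y, z))‖ₑ +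
        ENNReal.ofReal (lam * (bu (M.T k (y, z)) - bl (M.T k (y, z))))) ∂Q.measure ≤
      ENNReal.ofReal ((1 + lam * α) * (bu y.1.1 - bl y.1.1)) := by
  have hm : Measurable fun z => M.c k (y, M.T k (y, z)) :=
    (hM.measurable_cT k).comp measurable_prodMk_left
  have hb0 : 0 ≤ bu y.1.1 - bl y.1.1 := by linarith [hb.one_le y.1.1]
  simp only [ENNReal.ofReal_mul hlam]
  rw [lintegral_add_left hm.enorm, lintegral_const_mul' _ _ ENNReal.ofReal_ne_top]
  calc _ ≤ ENNReal.ofReal (bu y.1.1 - bl y.1.1) +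
          ENNReal.ofReal lam * (ENNReal.ofReal α * ENNReal.ofReal (bu y.1.1 - bl y.1.1)) := by
        gcongr
        · exact hb.lintegral_cost_le hM k Q y
        · exact hb.lintegral_drift_le k Q y
    _ = _ := by
        rw [← ENNReal.ofReal_mul hb.α_nonneg, ← ENNReal.ofReal_mul hlam, ← ENNReal.ofReal_add hb0
          (mul_nonneg hlam (mul_nonneg hb.α_nonneg hb0))]
        congr 1
        ring

theorem Bounding.lintegral_integrand_le (hM : M.ContinuityCompactness)
    (hb : M.Bounding α εl εu bl bu) (k : Fin N) {v : E → ℝ} {lam : ℝ} (hlam : 0 ≤ lam)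
    (hv : ∀ x, |v x| ≤ lam * (bu x - bl x)) (y : M.D k) (Q : M.Amb k) :
    ∫⁻ z, ‖M.integrand k v y z‖ₑ ∂Q.measure ≤
      ENNReal.ofReal ((1 + lam * α) * (bu y.1.1 - bl y.1.1)) := by
  refine le_trans (lintegral_mono fun z => (enorm_add_le _ _).trans ?_)
    (hb.lintegral_cost_add_drift_le hM k hlam y Q)
  gcongr
  rw [Real.enorm_eq_ofReal_abs]
  exact ENNReal.ofReal_le_ofReal (hv _)

theorem Bounding.integrable_integrand (hM : M.ContinuityCompactness)
    (hb : M.Bounding α εl εu bl bu) (k : Fin N) {v : E → ℝ}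
    (hv : v ∈ LscBounded fun x => bu x - bl x) (y : M.D k) (Q : M.Amb k) :
    Integrable (M.integrand k v y) Q.measure := by
  obtain ⟨hvm, -, lam, hlam, hv⟩ := hv
  exact ⟨(hM.measurable_integrand k hvm y).aestronglyMeasurable,
    (hb.lintegral_integrand_le hM k hlam hv y Q).trans_lt ENNReal.ofReal_lt_top⟩

theorem Bounding.abs_L_le (hM : M.ContinuityCompactness)
    (hb : M.Bounding α εl εu bl bu) (k : Fin N) {v : E → ℝ} {lam : ℝ} (hlam : 0 ≤ lam)
    (hv : ∀ x, |v x| ≤ lam * (bu x - bl x)) (y : M.D k) (Q : M.Amb k) :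
    |M.L k v y Q| ≤ (1 + lam * α) * (bu y.1.1 - bl y.1.1) := by
  have hb0 : 0 ≤ bu y.1.1 - bl y.1.1 := by linarith [hb.one_le y.1.1]
  have h0 : 0 ≤ (1 + lam * α) * (bu y.1.1 - bl y.1.1) :=
    mul_nonneg (by linarith [mul_nonneg hlam hb.α_nonneg]) hb0
  rw [← ENNReal.ofReal_le_ofReal_iff h0, ← Real.enorm_eq_ofReal_abs]
  exact (enorm_integral_le_lintegral_enorm _).trans
    (hb.lintegral_integrand_le hM k hlam hv y Q)

/-- Locally uniformly in the state-action pair, the integrand of `L_k v` is dominated by a function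
in `L^p`. -/
theorem Bounding.exists_memLp_bound (hb : M.Bounding α εl εu bl bu) (k : Fin N) {v : E → ℝ}
    (hv : v ∈ LscBounded fun x => bu x - bl x) (y₀ : M.D k) :
    ∃ Θ : Z → ℝ, Measurable Θ ∧ MemLp Θ M.p (M.P k) ∧
      ∀ᶠ y in 𝓝 y₀, ∀ z, |M.integrand k v y z| ≤ Θ z := by
  obtain ⟨-, -, lam, hlam, hv⟩ := hv
  obtain ⟨U, hU, Θ₁, Θ₂, h1m, h2m, -, -, h1, h2, h⟩ := hb.local_bound k y₀
  refine ⟨fun z => Θ₁ z + lam * Θ₂ z, h1m.add (h2m.const_mul lam), h1.add (h2.const_mul lam), ?_⟩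
  filter_upwards [continuous_subtype_val.continuousAt hU] with y hy z
  obtain ⟨h3, h4⟩ := h y hy z
  refine (abs_add_le _ _).trans (add_le_add h3 ((hv _).trans ?_))
  gcongr

theorem Bounding.memLp_integrand (hM : M.ContinuityCompactness)
    (hb : M.Bounding α εl εu bl bu) (k : Fin N) {v : E → ℝ}
    (hv : v ∈ LscBounded fun x => bu x - bl x) (y : M.D k) :
    MemLp (M.integrand k v y) M.p (M.P k) := by
  obtain ⟨Θ, -, hΘ, h⟩ := hb.exists_memLp_bound k hv y
  exact hΘ.mono' (hM.measurable_integrand k hv.1 y).aestronglyMeasurable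
    (ae_of_all _ (h.self_of_nhds))

theorem Bounding.continuous_L (hM : M.ContinuityCompactness)
    (hb : M.Bounding α εl εu bl bu) (k : Fin N) {v : E → ℝ}
    (hv : v ∈ LscBounded fun x => bu x - bl x) (y : M.D k) : Continuous (M.L k v y) :=
  Amb.continuous_integral (hb.memLp_integrand hM k hv y)

/-- Fatou's lemma: `L_k v` is lower semicontinuous in the state-action pair. -/
theorem Bounding.lowerSemicontinuous_L (hM : M.ContinuityCompactness)
    (hb : M.Bounding α εl εu bl bu) (k : Fin N) {v : E → ℝ}
    (hv : v ∈ LscBounded fun x => bu x - bl x) (Q : M.Amb k) :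
    LowerSemicontinuous fun y => M.L k v y Q := by
  intro y₀
  obtain ⟨Θ, hΘm, hΘ, hbd⟩ := hb.exists_memLp_bound k hv y₀
  have hΘi := Q.integrable hΘ
  have hlsc : ∀ z, LowerSemicontinuous fun y => M.integrand k v y z := fun z =>
    ((hM.lowerSemicontinuous_c k).comp (continuous_id.prodMk (hM.continuous_T k z))).add
      (hv.2.1.comp (hM.continuous_T k z))
  -- adding the dominating function `Θ` makes the integrand nonnegative near `y₀`
  let G : M.D k → ℝ≥0∞ := fun y => ∫⁻ z, ENNReal.ofReal (M.integrand k v y z + Θ z) ∂Q.measure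
  have hG : LowerSemicontinuousAt G y₀ := by
    rw [lowerSemicontinuousAt_iff_le_liminf]
    refine le_trans (lintegral_mono fun z => ?_)
      (lintegral_liminf_le fun y =>
        ((hM.measurable_integrand k hv.1 y).add hΘm).ennreal_ofReal)
    refine LowerSemicontinuousAt.le_liminf (f := fun y =>
      ENNReal.ofReal (M.integrand k v y z + Θ z)) ?_
    exact ENNReal.continuous_ofReal.continuousAt.comp_lowerSemicontinuousAt
      (LowerSemicontinuousAt.add (hlsc z y₀) continuousAt_const.lowerSemicontinuousAt) ENNReal.ofReal_mono
  have hGL : ∀ᶠ y in 𝓝 y₀, 0 ≤ M.L k v y Q + ∫ z, Θ z ∂Q.measure ∧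
      G y = ENNReal.ofReal (M.L k v y Q + ∫ z, Θ z ∂Q.measure) := by
    filter_upwards [hbd] with y hy
    have hi := hb.integrable_integrand hM k hv y Q
    have h1 : M.L k v y Q + ∫ z, Θ z ∂Q.measure = ∫ z, (M.integrand k v y z + Θ z) ∂Q.measure :=
      (integral_add hi hΘi).symm
    have h0 : ∀ z, 0 ≤ M.integrand k v y z + Θ z := fun z => by
      linarith [neg_abs_le (M.integrand k v y z), hy z]
    exact ⟨h1 ▸ integral_nonneg h0, h1 ▸
      (ofReal_integral_eq_lintegral_ofReal (hi.add hΘi) (ae_of_all _ h0)).symm⟩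
  intro t ht
  rcases lt_or_ge (t + ∫ z, Θ z ∂Q.measure) 0 with hneg | hpos
  · filter_upwards [hGL] with y hy
    linarith [hy.1]
  · have h1 : ENNReal.ofReal (t + ∫ z, Θ z ∂Q.measure) < G y₀ := by
      rw [hGL.self_of_nhds.2, ENNReal.ofReal_lt_ofReal_iff_of_nonneg hpos]
      linarith
    filter_upwards [hG _ h1, hGL] with y hy hy'
    rw [hy'.2, gt_iff_lt, ENNReal.ofReal_lt_ofReal_iff_of_nonneg hpos] at hy
    linarith

end Bounds

end RobustMDP

namespace RobustMDP

variable {N : ℕ} {E A Z : Type*}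
    [TopologicalSpace E] [TopologicalSpace.MetrizableSpace E] [SecondCountableTopology E]
    [MeasurableSpace E] [BorelSpace E]
    [TopologicalSpace A] [TopologicalSpace.MetrizableSpace A] [SecondCountableTopology A]
    [MeasurableSpace A] [BorelSpace A]
    [MeasurableSpace Z] {M : RobustMDP N E A Z} {α εl εu : ℝ} {bl bu : E → ℝ}

/-! ### Worst-case costs, their minimizers, and the selections of nature -/

/-- The worst-case value `sup_Q L_k v(x, a, Q)` of a state-action pair. -/
def worstCase (M : RobustMDP N E A Z) (k : Fin N) (v : E → ℝ) (y : M.D k) : ℝ :=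
  ⨆ Q : M.Amb k, M.L k v y Q

theorem Bounding.bddAbove_L (hM : M.ContinuityCompactness)
    (hb : M.Bounding α εl εu bl bu) (k : Fin N) {v : E → ℝ}
    (hv : v ∈ LscBounded fun x => bu x - bl x) (y : M.D k) :
    BddAbove (Set.range fun Q : M.Amb k => M.L k v y Q) := by
  obtain ⟨-, -, lam, hlam, hv⟩ := hv
  exact ⟨_, by rintro _ ⟨Q, rfl⟩; exact (abs_le.mp (hb.abs_L_le hM k hlam hv y Q)).2⟩

theorem Bounding.L_le_worstCase (hM : M.ContinuityCompactness)
    (hb : M.Bounding α εl εu bl bu) (k : Fin N) {v : E → ℝ}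
    (hv : v ∈ LscBounded fun x => bu x - bl x) (y : M.D k) (Q : M.Amb k) :
    M.L k v y Q ≤ M.worstCase k v y :=
  le_ciSup (hb.bddAbove_L hM k hv y) Q

theorem Bounding.coe_worstCase (hM : M.ContinuityCompactness)
    (hb : M.Bounding α εl εu bl bu) (k : Fin N) {v : E → ℝ}
    (hv : v ∈ LscBounded fun x => bu x - bl x) (y : M.D k) :
    (M.worstCase k v y : EReal) = ⨆ Q : M.Amb k, (M.L k v y Q : EReal) :=
  EReal.coe_ciSup (hb.bddAbove_L hM k hv y)

theorem Bounding.abs_worstCase_le (hM : M.ContinuityCompactness)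
    (hb : M.Bounding α εl εu bl bu) (k : Fin N) {v : E → ℝ} {lam : ℝ} (hlam : 0 ≤ lam)
    (hv : ∀ x, |v x| ≤ lam * (bu x - bl x)) (y : M.D k) :
    |M.worstCase k v y| ≤ (1 + lam * α) * (bu y.1.1 - bl y.1.1) := by
  have h := hb.abs_L_le hM k hlam hv y
  refine abs_le.mpr ⟨?_, ciSup_le fun Q => (abs_le.mp (h Q)).2⟩
  obtain ⟨Q⟩ := (inferInstance : Nonempty (M.Amb k))
  exact (abs_le.mp (h Q)).1.trans
    (le_ciSup (f := fun Q => M.L k v y Q)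
      ⟨_, by rintro _ ⟨Q, rfl⟩; exact (abs_le.mp (h Q)).2⟩ Q)

theorem Bounding.lowerSemicontinuous_worstCase (hM : M.ContinuityCompactness)
    (hb : M.Bounding α εl εu bl bu) (k : Fin N) {v : E → ℝ}
    (hv : v ∈ LscBounded fun x => bu x - bl x) : LowerSemicontinuous (M.worstCase k v) :=
  lowerSemicontinuous_ciSup (hb.bddAbove_L hM k hv) fun Q => hb.lowerSemicontinuous_L hM k hv Q

/-- The states from which some admissible action in a closed set keeps a lower semicontinuous
function below a given level form a closed set. -/
theorem ContinuityCompactness.isClosed_sublevel (hM : M.ContinuityCompactness) (k : Fin N)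
    {g : M.D k → ℝ} (hg : LowerSemicontinuous g) {F : Set A} (hF : IsClosed F) (t : ℝ) :
    IsClosed {x | ∃ a, ∃ h : (x, a) ∈ M.D k, a ∈ F ∧ g ⟨(x, a), h⟩ ≤ t} := by
  refine isSeqClosed_iff_isClosed.mp fun x x₀ hx hlim => ?_
  choose a ha haF hat using hx
  obtain ⟨a₀, ha₀, hcl⟩ := hM.upperSemicontinuous_section k x a x₀ hlim ha
  obtain ⟨φ, hφ, hφlim⟩ := hcl.tendsto_subseq
  refine ⟨a₀, ha₀, hF.mem_of_tendsto hφlim (Eventually.of_forall fun i => haF (φ i)), ?_⟩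
  have hlim' : Tendsto (fun i => (⟨(x (φ i), a (φ i)), ha (φ i)⟩ : M.D k)) atTop
      (𝓝 ⟨(x₀, a₀), ha₀⟩) := by
    rw [tendsto_subtype_rng]
    exact (hlim.comp hφ.tendsto_atTop).prodMk_nhds hφlim
  have hc : IsClosed {y | g y ≤ t} := hg.isClosed_preimage t
  exact hc.mem_of_tendsto hlim' (Eventually.of_forall fun i => hat (φ i))

theorem ContinuityCompactness.exists_minimizer (hM : M.ContinuityCompactness) (k : Fin N)
    {g : M.D k → ℝ} (hg : LowerSemicontinuous g) :
    ∃ d : M.MarkovRule k, ∀ x a (h : (x, a) ∈ M.D k), g (d.pair x) ≤ g ⟨(x, a), h⟩ := by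
  classical
  let Φ : E → Set A := fun x => {a | (x, a) ∈ M.D k}
  let f : E → A → ℝ := fun x a => if h : (x, a) ∈ M.D k then g ⟨(x, a), h⟩ else 0
  have hf : ∀ x a (h : (x, a) ∈ M.D k), f x a = g ⟨(x, a), h⟩ := fun x a h => dif_pos h
  obtain ⟨d₀, -, hd₀⟩ := M.exists_graph k
  have hΦ : CompactMultifunction fun x => argminOn (Φ x) (f x) := by
    refine CompactMultifunction.argmin (hM.isCompact_section k) (fun x => ⟨d₀ x, hd₀ x⟩)
      (fun x => ?_) fun F hF t => ?_
    · rw [← lowerSemicontinuous_restrict_iff]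
      have : (Φ x).domRestrict (f x) = fun a => g ⟨(x, a.1), a.2⟩ := by
        ext a
        exact hf x a.1 a.2
      rw [this]
      exact hg.comp (Continuous.subtype_mk (by fun_prop) _)
    · convert (hM.isClosed_sublevel k hg hF t).measurableSet using 1
      ext x
      constructor
      · rintro ⟨a, ⟨ha, haF⟩, hat⟩
        exact ⟨a, ha, haF, hf x a ha ▸ hat⟩
      · rintro ⟨a, ha, haF, hat⟩
        exact ⟨a, ⟨ha, haF⟩, (hf x a ha).symm ▸ hat⟩
  obtain ⟨u, hu, hsep⟩ := exists_continuous_separating A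
  obtain ⟨d, hd, hdΦ⟩ := hΦ.exists_selector u hu hsep
  refine ⟨⟨d, hd, fun x => (hdΦ x).1⟩, fun x a h => ?_⟩
  have h1 : f x (d x) ≤ f x a := (hdΦ x).2 h
  rwa [hf x a h, hf x (d x) (hdΦ x).1] at h1

/-- The robust Bellman operator maps `𝔹` into itself, and its infimum is attained by a Markov
minimizer. -/
theorem Bounding.exists_op_eq (hM : M.ContinuityCompactness)
    (hb : M.Bounding α εl εu bl bu) (k : Fin N) {v : E → ℝ}
    (hv : v ∈ LscBounded fun x => bu x - bl x) :
    ∃ w ∈ LscBounded (fun x => bu x - bl x), (∀ x, (w x : EReal) = M.op k v x) ∧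
      ∃ d : M.MarkovRule k, M.IsMinimizer k v d := by
  have hg := hb.lowerSemicontinuous_worstCase hM k hv
  obtain ⟨d, hd⟩ := hM.exists_minimizer k hg
  have hop : ∀ x, (M.worstCase k v (d.pair x) : EReal) = M.op k v x := by
    intro x
    refine le_antisymm (le_iInf fun a => ?_) (iInf_le_of_le ⟨d.toFun x, d.feasible x⟩ ?_)
    · rw [← hb.coe_worstCase hM k hv]
      exact EReal.coe_le_coe (hd x a.1 a.2)
    · rw [← hb.coe_worstCase hM k hv]
      exact le_rfl
  have hlsc : LowerSemicontinuous fun x => M.worstCase k v (d.pair x) := by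
    rw [lowerSemicontinuous_iff_isClosed_preimage]
    intro t
    convert hM.isClosed_sublevel k hg isClosed_univ t using 1
    ext x
    constructor
    · intro h
      exact ⟨d.toFun x, d.feasible x, trivial, h⟩
    · rintro ⟨a, ha, -, hat⟩
      exact (hd x a ha).trans hat
  obtain ⟨-, -, lam, hlam, hv'⟩ := id hv
  refine ⟨fun x => M.worstCase k v (d.pair x), ⟨hlsc.measurable, hlsc, 1 + lam * α, ?_, fun x =>
    hb.abs_worstCase_le hM k hlam hv' (d.pair x)⟩, hop, d, fun x => ?_⟩
  · linarith [mul_nonneg hlam hb.α_nonneg]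
  · rw [← hop, hb.coe_worstCase hM k hv]
    rfl

/-- Nature has `ε`-optimal Markov decision rules: choose the first `ε`-optimal member of a weak*
dense sequence. -/
theorem Bounding.exists_natMarkovRule_le_add (hM : M.ContinuityCompactness)
    (hb : M.Bounding α εl εu bl bu) (k : Fin N) {v : E → ℝ}
    (hv : v ∈ LscBounded fun x => bu x - bl x) {ε : ℝ} (hε : 0 < ε) :
    ∃ γ : M.NatMarkovRule k, ∀ y, M.worstCase k v y ≤ M.L k v y (γ.toFun y) + ε := by
  classical
  obtain ⟨K, hK⟩ := hb.exists_norm_density_le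
  have := Amb.secondCountableTopology (hK k)
  let Q : ℕ → M.Amb k := TopologicalSpace.denseSeq (M.Amb k)
  have hex : ∀ y, ∃ i, M.worstCase k v y < M.L k v y (Q i) + ε := by
    intro y
    obtain ⟨Q', hQ'⟩ := exists_lt_of_lt_ciSup (show M.worstCase k v y - ε < _ from
      sub_lt_self _ hε)
    have ho : IsOpen {Q | M.worstCase k v y - ε < M.L k v y Q} :=
      isOpen_lt continuous_const (hb.continuous_L hM k hv y)
    obtain ⟨i, hi⟩ := (TopologicalSpace.denseRange_denseSeq (M.Amb k)).exists_mem_open ho ⟨Q', hQ'⟩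
    exact ⟨i, sub_lt_iff_lt_add.mp hi⟩
  refine ⟨⟨fun y => Q (Nat.find (hex y)), measurable_from_top.comp (measurable_find hex fun i => ?_)⟩,
    fun y => (Nat.find_spec (hex y)).le⟩
  exact measurableSet_lt (hb.lowerSemicontinuous_worstCase hM k hv).measurable
    ((hb.lowerSemicontinuous_L hM k hv (Q i)).measurable.add_const ε)

/-- If the ambiguity set is weak* closed, hence weak* compact, nature has optimal Markov decision
rules. -/
theorem Bounding.exists_natMarkovRule_isMax (hM : M.ContinuityCompactness)
    (hb : M.Bounding α εl εu bl bu) (k : Fin N) (hcl : M.WeakStarClosed k) {v : E → ℝ}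
    (hv : v ∈ LscBounded fun x => bu x - bl x) :
    ∃ γ : M.NatMarkovRule k, ∀ y Q, M.L k v y Q ≤ M.L k v y (γ.toFun y) := by
  obtain ⟨K, hK⟩ := hb.exists_norm_density_le
  have := Amb.secondCountableTopology (hK k)
  have := Amb.compactSpace (hK k) hcl
  have := Amb.t2Space (M := M) (k := k)
  have hΦ : CompactMultifunction fun y : M.D k =>
      argminOn (Set.univ : Set (M.Amb k)) (fun Q => -M.L k v y Q) := by
    refine CompactMultifunction.argmin (Φ := fun _ => Set.univ) (f := fun y Q => -M.L k v y Q)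
      (fun _ => isCompact_univ) (fun _ => Set.univ_nonempty)
      (fun y => (hb.continuous_L hM k hv y).neg.lowerSemicontinuous.lowerSemicontinuousOn _)
      fun F hF t => ?_
    rcases F.eq_empty_or_nonempty with rfl | hne
    · simp
    have : Nonempty F := hne.to_subtype
    let Q : ℕ → F := TopologicalSpace.denseSeq F
    -- the minimum over the compact set `F` is an infimum over a dense sequence in `F`
    have : {y | ∃ R ∈ Set.univ ∩ F, -M.L k v y R ≤ t} =
        ⋂ n : ℕ, ⋃ i, {y | -M.L k v y (Q i) < t + 1 / ((n : ℝ) + 1)} := by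
      ext y
      simp only [Set.mem_iInter, Set.mem_iUnion, Set.univ_inter]
      constructor
      · rintro ⟨R, hR, hRt⟩ n
        have ho : IsOpen {S : F | -M.L k v y S < t + 1 / ((n : ℝ) + 1)} :=
          isOpen_lt ((hb.continuous_L hM k hv y).neg.comp continuous_subtype_val) continuous_const
        exact (TopologicalSpace.denseRange_denseSeq F).exists_mem_open ho
          ⟨⟨R, hR⟩, lt_of_le_of_lt hRt (by linarith [Nat.one_div_pos_of_nat (α := ℝ) (n := n)])⟩
      · intro h
        obtain ⟨R, hR, hRm⟩ := hF.isCompact.exists_isMinOn hne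
          (hb.continuous_L hM k hv y).neg.continuousOn
        refine ⟨R, hR, le_of_forall_pos_lt_add fun ε hε => ?_⟩
        obtain ⟨n, hn⟩ := exists_nat_one_div_lt hε
        obtain ⟨i, hi⟩ := h n
        have h1 : -M.L k v y R ≤ -M.L k v y (Q i) := hRm (Q i).2
        have h2 : -M.L k v y (Q i) < t + 1 / ((n : ℝ) + 1) := hi
        linarith
    rw [this]
    exact MeasurableSet.iInter fun n => MeasurableSet.iUnion fun i =>
      measurableSet_lt (hb.lowerSemicontinuous_L hM k hv (Q i)).measurable.neg measurable_const
  obtain ⟨γ, hγ, hγΦ⟩ := hΦ.exists_selector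
    (fun i Q => Q.pairing (TopologicalSpace.denseSeq (Lp ℝ M.p (M.P k)) i))
    (fun i => Amb.continuous_pairing _) fun Q Q' h => Amb.eq_of_pairing_denseSeq h
  refine ⟨⟨γ, hγ⟩, fun y Q => ?_⟩
  have h1 : -M.L k v y (γ y) ≤ -M.L k v y Q := (hγΦ y).2 (Set.mem_univ Q)
  linarith

end RobustMDP

namespace RobustMDP

/-! ### The law of motion -/

section Law

variable {N : ℕ} {E A Z : Type*} [MeasurableSpace E] [MeasurableSpace A] [MeasurableSpace Z]
  {M : RobustMDP N E A Z}

/-- The controller's kernel is the law of `(h, a)`, `a ∼ κ(· | h)`, restricted to admissible pairs;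
the restriction loses no mass since `κ` is feasible. -/
theorem RandRule.kernel_apply {k : Fin N} (κ : M.RandRule k) (h : M.Hist k.castSucc) :
    κ.kernel h = ((κ.toKernel h).map (Prod.mk h)).comap Subtype.val := by
  have := κ.isMarkovKernel
  rw [RandRule.kernel, Kernel.comapRight_apply, Kernel.prod_apply, Kernel.id_apply,
    Measure.dirac_prod]

instance {k : Fin N} (κ : M.RandRule k) : IsMarkovKernel κ.kernel := by
  have := κ.isMarkovKernel
  refine Kernel.IsMarkovKernel.comapRight _ _ fun h => ?_
  have hr : Set.range (Subtype.val : M.HistAct k → M.Hist k.castSucc × A) =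
      {r | (r.1.last, r.2) ∈ M.D k} := Subtype.range_val
  rw [Kernel.prod_apply, Kernel.id_apply, Measure.dirac_prod,
    Measure.map_apply measurable_prodMk_left (M.measurableEmbedding_histAct k).measurableSet_range,
    hr]
  exact κ.feasible h

/-- A property of history and action holds almost surely after the controller's choice if it holds
for the given history and almost all actions. -/
theorem RandRule.ae_kernel {k : Fin N} (κ : M.RandRule k) (h : M.Hist k.castSucc)
    {P : M.Hist k.castSucc × A → Prop} (hP : MeasurableSet {r | P r})
    (ha : ∀ᵐ a ∂κ.toKernel h, P (h, a)) : ∀ᵐ r ∂κ.kernel h, P r.1 := by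
  have he := M.measurableEmbedding_histAct k
  have h1 : ∀ᵐ r ∂((κ.toKernel h).map (Prod.mk h)), P r :=
    (ae_map_iff measurable_prodMk_left.aemeasurable hP).mpr ha
  rw [κ.kernel_apply, ← he.ae_map_iff, he.map_comap]
  exact ae_restrict_of_ae h1

instance {k : Fin N} (γ : M.NatRule k) : IsMarkovKernel γ.kernel :=
  ⟨fun r => inferInstanceAs (IsProbabilityMeasure (γ.toFun r).measure)⟩

theorem measurable_next_left (k : Fin N) (r : M.HistAct k) : Measurable fun z => M.next k (r, z) :=
  (M.measurable_next k).comp measurable_prodMk_left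

/-- The transition from a history with action to the successor history. -/
def NatRule.nextKernel {k : Fin N} (γ : M.NatRule k) : Kernel (M.HistAct k) (M.Hist k.succ) :=
  (Kernel.id ×ₖ γ.kernel).map (M.next k)

theorem NatRule.nextKernel_apply {k : Fin N} (γ : M.NatRule k) (r : M.HistAct k) :
    γ.nextKernel r = (γ.toFun r).measure.map fun z => M.next k (r, z) := by
  rw [NatRule.nextKernel, Kernel.map_apply _ (M.measurable_next k), Kernel.prod_apply,
    Kernel.id_apply, Measure.dirac_prod, Measure.map_map (M.measurable_next k)
      measurable_prodMk_left]
  rfl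

instance {k : Fin N} (γ : M.NatRule k) : IsMarkovKernel γ.nextKernel :=
  Kernel.IsMarkovKernel.map _ (M.measurable_next k)

theorem step_eq {k : Fin N} (κ : M.RandRule k) (γ : M.NatRule k) :
    M.step κ γ = γ.nextKernel ∘ₖ κ.kernel := rfl

instance {k : Fin N} (κ : M.RandRule k) (γ : M.NatRule k) : IsMarkovKernel (M.step κ γ) := by
  rw [step_eq]
  infer_instance

variable (M) in
theorem law_last (π : M.RandPolicy) (γ : M.NatPolicy) : M.law π γ (Fin.last N) = Kernel.id := by
  rw [law, Fin.reverseInduction_last]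

variable (M) in
theorem law_castSucc (π : M.RandPolicy) (γ : M.NatPolicy) (k : Fin N) :
    M.law π γ k.castSucc = M.law π γ k.succ ∘ₖ M.step (π k) (γ k) := by
  rw [law, Fin.reverseInduction_castSucc]
  rfl

instance (π : M.RandPolicy) (γ : M.NatPolicy) (n : Fin (N + 1)) :
    IsMarkovKernel (M.law π γ n) := by
  induction n using Fin.reverseInduction with
  | last =>
    rw [law_last]
    infer_instance
  | cast k ih =>
    rw [law_castSucc]
    infer_instance

theorem last_next (k : Fin N) (r : M.HistAct k) (z : Z) :
    (M.next k (r, z)).last = M.T k (r.pair, z) :=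
  Fin.snoc_last (α := fun _ => E) (n := k.val + 1) _ _

/-- The complete history `h'` starts with the history `h` up to time `n`. -/
def Extends {n : Fin (N + 1)} (h : M.Hist n) (h' : M.Hist (Fin.last N)) : Prop :=
  (∀ j : Fin (n.val + 1), h'.1.1 ⟨j, by have := n.isLt; have := j.isLt; simp; omega⟩ = h.1.1 j) ∧
    ∀ j : Fin n.val, h'.1.2 ⟨j, by have := n.isLt; have := j.isLt; simp; omega⟩ = h.1.2 j

theorem Extends.of_next {k : Fin N} {r : M.HistAct k} {z : Z} {h' : M.Hist (Fin.last N)}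
    (h : Extends (M.next k (r, z)) h') : Extends r.1.1 h' := by
  refine ⟨fun j => (h.1 j.castSucc).trans ?_, fun j => (h.2 j.castSucc).trans ?_⟩
  · exact Fin.snoc_castSucc (α := fun _ => E) (n := k.val + 1) _ _ j
  · exact Fin.snoc_castSucc (α := fun _ => A) (n := k.val) _ _ j

theorem Extends.pairAt_eq {k : Fin N} {r : M.HistAct k} {z : Z} {h' : M.Hist (Fin.last N)}
    (h : Extends (M.next k (r, z)) h') : M.pairAt h' k = r.pair := by
  have h1 := (h.of_next).1 (Fin.last k.val)
  have h2 := (h.2 (Fin.last k.val)).trans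
    (Fin.snoc_last (α := fun _ => A) (n := k.val) _ _)
  exact Subtype.ext (Prod.ext h1 h2)

theorem Extends.state_succ_eq {k : Fin N} {r : M.HistAct k} {z : Z} {h' : M.Hist (Fin.last N)}
    (h : Extends (M.next k (r, z)) h') : h'.1.1 k.succ = M.T k (r.pair, z) :=
  (h.1 (Fin.last (k.val + 1))).trans (last_next k r z)

theorem measurableSet_extends [MeasurableSingletonClass E] [MeasurableSingletonClass A]
    {n : Fin (N + 1)} (h : M.Hist n) : MeasurableSet {h' | Extends h h'} := by
  have h1 : Measurable fun h' : M.Hist (Fin.last N) => h'.1.1 :=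
    measurable_fst.comp measurable_subtype_coe
  have h2 : Measurable fun h' : M.Hist (Fin.last N) => h'.1.2 :=
    measurable_snd.comp measurable_subtype_coe
  have h3 : {h' | Extends h h'} =
      (⋂ j : Fin (n.val + 1), {h' : M.Hist (Fin.last N) |
        h'.1.1 ⟨j, by have := n.isLt; have := j.isLt; simp; omega⟩ ∈ ({h.1.1 j} : Set E)}) ∩
      ⋂ j : Fin n.val, {h' : M.Hist (Fin.last N) |
        h'.1.2 ⟨j, by have := n.isLt; have := j.isLt; simp; omega⟩ ∈ ({h.1.2 j} : Set A)} := by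
    ext h'
    simp [Extends]
  rw [h3]
  exact (MeasurableSet.iInter fun j =>
      ((measurable_pi_apply _).comp h1) (measurableSet_singleton _)).inter
    (MeasurableSet.iInter fun j =>
      ((measurable_pi_apply _).comp h2) (measurableSet_singleton _))

/-- The controller's choice does not change the history. -/
theorem RandRule.ae_kernel_hist_eq [MeasurableSingletonClass E] [MeasurableSingletonClass A]
    {k : Fin N} (κ : M.RandRule k) (h : M.Hist k.castSucc) : ∀ᵐ r ∂κ.kernel h, r.1.1 = h :=
  κ.ae_kernel h (P := fun r => r.1 = h) (measurable_fst (measurableSet_singleton h))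
    (ae_of_all _ fun _ => rfl)

theorem MarkovRule.ae_kernel_toRand [MeasurableSingletonClass E] [MeasurableSingletonClass A]
    {k : Fin N} (d : M.MarkovRule k) (h : M.Hist k.castSucc) :
    ∀ᵐ r ∂d.toRand.kernel h, r = ⟨(h, d.toFun h.last), d.feasible _⟩ := by
  have := d.toRand.ae_kernel h (P := fun r => r = (h, d.toFun h.last))
    (measurableSet_singleton _) ?_
  · filter_upwards [this] with r hr using Subtype.ext hr
  · rw [MarkovRule.toRand, Kernel.deterministic_apply]
    exact (ae_dirac_iff (p := fun a => (h, a) = (h, d.toFun h.last))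
      (measurable_prodMk_left (measurableSet_singleton _))).mpr rfl

/-- Under the law of motion from time `n` on, the history up to time `n` is fixed. -/
theorem ae_law_extends [MeasurableSingletonClass E] [MeasurableSingletonClass A]
    (π : M.RandPolicy) (γ : M.NatPolicy) (n : Fin (N + 1)) (h : M.Hist n) :
    ∀ᵐ h' ∂M.law π γ n h, Extends h h' := by
  induction n using Fin.reverseInduction with
  | last =>
    rw [law_last, Kernel.id_apply, ae_dirac_iff (measurableSet_extends h)]
    exact ⟨fun _ => rfl, fun _ => rfl⟩
  | cast k ih =>
    have hE := measurableSet_extends (M := M) h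
    rw [law_castSucc, step_eq, ← Kernel.comp_assoc]
    refine Kernel.ae_comp_of_ae_ae hE ?_
    filter_upwards [(π k).ae_kernel_hist_eq h] with r hr
    refine Kernel.ae_comp_of_ae_ae hE ?_
    rw [(γ k).nextKernel_apply, ae_map_iff (measurable_next_left k r).aemeasurable]
    · refine ae_of_all _ fun z => ?_
      filter_upwards [ih (M.next k (r, z))] with h' hh'
      exact hr ▸ hh'.of_next
    · exact measurableSet_eq_fun (Kernel.measurable_coe _ hE.compl) measurable_const

theorem lintegral_law_castSucc (π : M.RandPolicy) (γ : M.NatPolicy) (k : Fin N)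
    (h : M.Hist k.castSucc) {f : M.Hist (Fin.last N) → ℝ≥0∞} (hf : Measurable f) :
    ∫⁻ h', f h' ∂M.law π γ k.castSucc h =
      ∫⁻ r, ∫⁻ z, ∫⁻ h', f h' ∂M.law π γ k.succ (M.next k (r, z)) ∂((γ k).toFun r).measure
        ∂(π k).kernel h := by
  rw [law_castSucc, Kernel.lintegral_comp _ _ _ hf, step_eq,
    Kernel.lintegral_comp _ _ _ hf.lintegral_kernel]
  refine lintegral_congr fun r => ?_
  rw [(γ k).nextKernel_apply, lintegral_map hf.lintegral_kernel (measurable_next_left k r)]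

theorem totalCost_castSucc (k : Fin N) (h' : M.Hist (Fin.last N)) :
    M.totalCost k.castSucc h' =
      M.c k (M.pairAt h' k, h'.1.1 k.succ) + M.totalCost k.succ h' := by
  have h1 : ∀ j : Fin N, (if k.castSucc.val ≤ j.val then M.c j (M.pairAt h' j, h'.1.1 j.succ) else 0)
      = (if k = j then M.c j (M.pairAt h' j, h'.1.1 j.succ) else 0) +
        (if k.succ.val ≤ j.val then M.c j (M.pairAt h' j, h'.1.1 j.succ) else 0) := by
    intro j
    rcases lt_trichotomy k j with h | rfl | h
    · have h2 : k.val < j.val := h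
      simp [h.ne, h2.le, Nat.succ_le_of_lt h2]
    · simp
    · have h2 : j.val < k.val := h
      simp [h.ne', not_le.mpr h2, not_le.mpr (h2.trans (Nat.lt_succ_self _))]
  simp only [totalCost, h1, Finset.sum_add_distrib, Finset.sum_ite_eq, Finset.mem_univ, if_true,
    add_assoc]

theorem totalCost_last (h' : M.Hist (Fin.last N)) : M.totalCost (Fin.last N) h' = M.cN h'.last := by
  rw [totalCost, Finset.sum_eq_zero fun k _ => if_neg (not_le.mpr k.isLt), zero_add]

end Law

/-! ### Integrability and recursion for the values of policies -/

section Value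

variable {N : ℕ} {E A Z : Type*}
    [TopologicalSpace E] [TopologicalSpace.MetrizableSpace E] [SecondCountableTopology E]
    [MeasurableSpace E] [BorelSpace E]
    [TopologicalSpace A] [TopologicalSpace.MetrizableSpace A] [SecondCountableTopology A]
    [MeasurableSpace A] [BorelSpace A]
    [MeasurableSpace Z] {M : RobustMDP N E A Z} {α εl εu : ℝ} {bl bu : E → ℝ}

theorem ContinuityCompactness.measurable_totalCost (hM : M.ContinuityCompactness)
    (n : Fin (N + 1)) : Measurable (M.totalCost n) := by
  have h1 : Measurable fun h' : M.Hist (Fin.last N) => h'.1.1 :=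
    measurable_fst.comp measurable_subtype_coe
  have h2 : Measurable fun h' : M.Hist (Fin.last N) => h'.1.2 :=
    measurable_snd.comp measurable_subtype_coe
  refine (Finset.measurable_fun_sum _ fun k _ => ?_).add
    (hM.lowerSemicontinuous_cN.measurable.comp (M.measurable_last _))
  refine Measurable.ite (MeasurableSet.const _) ?_ measurable_const
  refine (hM.measurable_c k).comp (Measurable.prodMk ?_ ((measurable_pi_apply _).comp h1))
  exact (((measurable_pi_apply _).comp h1).prodMk ((measurable_pi_apply _).comp h2)).subtype_mk

/-- The total cost from time `n` on is integrable, with a bound proportional to `b(x_n)`. -/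
theorem Bounding.exists_lintegral_totalCost_le (hM : M.ContinuityCompactness)
    (hb : M.Bounding α εl εu bl bu) (n : Fin (N + 1)) :
    ∃ C : ℝ, 0 ≤ C ∧ ∀ π γ (h : M.Hist n), ∫⁻ h', ‖M.totalCost n h'‖ₑ ∂M.law π γ n h ≤
      ENNReal.ofReal (C * (bu h.last - bl h.last)) := by
  induction n using Fin.reverseInduction with
  | last =>
    refine ⟨1, zero_le_one, fun π γ h => ?_⟩
    rw [law_last, Kernel.id_apply,
      lintegral_dirac' _ (hM.measurable_totalCost _).enorm, totalCost_last, one_mul,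
      Real.enorm_eq_ofReal_abs]
    refine ENNReal.ofReal_le_ofReal (abs_le.mpr ⟨?_, ?_⟩) <;>
      linarith [hb.terminal h.last, hb.bl_nonpos h.last, hb.bu_nonneg h.last]
  | cast k ih =>
    obtain ⟨C, hC, ih⟩ := ih
    refine ⟨1 + C * α, by linarith [mul_nonneg hC hb.α_nonneg], fun π γ h => ?_⟩
    rw [lintegral_law_castSucc π γ k h (hM.measurable_totalCost _).enorm]
    have hin : ∀ (r : M.HistAct k) z,
        ∫⁻ h', ‖M.totalCost k.castSucc h'‖ₑ ∂M.law π γ k.succ (M.next k (r, z)) ≤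
          ‖M.c k (r.pair, M.T k (r.pair, z))‖ₑ +
            ENNReal.ofReal (C * (bu (M.T k (r.pair, z)) - bl (M.T k (r.pair, z)))) := by
      intro r z
      have h1 := ih π γ (M.next k (r, z))
      rw [last_next] at h1
      calc _ ≤ ∫⁻ h', (‖M.c k (r.pair, M.T k (r.pair, z))‖ₑ + ‖M.totalCost k.succ h'‖ₑ)
            ∂M.law π γ k.succ (M.next k (r, z)) := by
            refine lintegral_mono_ae ?_
            filter_upwards [ae_law_extends π γ k.succ (M.next k (r, z))] with h' hh'
            rw [totalCost_castSucc, hh'.pairAt_eq, hh'.state_succ_eq]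
            exact enorm_add_le _ _
        _ = ‖M.c k (r.pair, M.T k (r.pair, z))‖ₑ +
            ∫⁻ h', ‖M.totalCost k.succ h'‖ₑ ∂M.law π γ k.succ (M.next k (r, z)) := by
            rw [lintegral_add_left measurable_const]
            simp
        _ ≤ _ := add_le_add le_rfl h1
    calc _ ≤ ∫⁻ r, ENNReal.ofReal ((1 + C * α) * (bu r.pair.1.1 - bl r.pair.1.1))
          ∂(π k).kernel h := lintegral_mono fun r =>
            (lintegral_mono (hin r)).trans (hb.lintegral_cost_add_drift_le hM k hC _ _)
      _ = ∫⁻ r, ENNReal.ofReal ((1 + C * α) * (bu h.last - bl h.last)) ∂(π k).kernel h := by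
        refine lintegral_congr_ae ?_
        filter_upwards [(π k).ae_kernel_hist_eq h] with r hr
        simp only [← hr]
        rfl
      _ = _ := by simp

theorem Bounding.integrable_totalCost (hM : M.ContinuityCompactness)
    (hb : M.Bounding α εl εu bl bu) (π : M.RandPolicy) (γ : M.NatPolicy) (n : Fin (N + 1))
    (h : M.Hist n) : Integrable (M.totalCost n) (M.law π γ n h) := by
  obtain ⟨C, -, hC⟩ := hb.exists_lintegral_totalCost_le hM n
  exact ⟨(hM.measurable_totalCost n).aestronglyMeasurable,
    (hC π γ h).trans_lt ENNReal.ofReal_lt_top⟩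

theorem ContinuityCompactness.measurable_policyValue (hM : M.ContinuityCompactness)
    (π : M.RandPolicy) (γ : M.NatPolicy) (n : Fin (N + 1)) : Measurable (M.policyValue π γ n) :=
  ((hM.measurable_totalCost n).stronglyMeasurable.integral_kernel (κ := M.law π γ n)).measurable

theorem Bounding.exists_abs_policyValue_le (hM : M.ContinuityCompactness)
    (hb : M.Bounding α εl εu bl bu) (n : Fin (N + 1)) :
    ∃ C : ℝ, 0 ≤ C ∧ ∀ π γ (h : M.Hist n),
      |M.policyValue π γ n h| ≤ C * (bu h.last - bl h.last) := by
  obtain ⟨C, hC0, hC⟩ := hb.exists_lintegral_totalCost_le hM n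
  refine ⟨C, hC0, fun π γ h => ?_⟩
  have h0 : 0 ≤ C * (bu h.last - bl h.last) := mul_nonneg hC0 (by linarith [hb.one_le h.last])
  rw [← ENNReal.ofReal_le_ofReal_iff h0, ← Real.enorm_eq_ofReal_abs]
  exact (enorm_integral_le_lintegral_enorm _).trans (hC π γ h)

/-- The value, from the stage `k` on, of a history with action under the policies `π` and `γ`. -/
def actionValue (M : RobustMDP N E A Z) (π : M.RandPolicy) (γ : M.NatPolicy) (k : Fin N)
    (r : M.HistAct k) : ℝ :=
  ∫ z, (M.c k (r.pair, M.T k (r.pair, z)) + M.policyValue π γ k.succ (M.next k (r, z)))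
    ∂((γ k).toFun r).measure

theorem policyValue_last (π : M.RandPolicy) (γ : M.NatPolicy) (hM : M.ContinuityCompactness)
    (h : M.Hist (Fin.last N)) : M.policyValue π γ (Fin.last N) h = M.cN h.last := by
  rw [policyValue, law_last, Kernel.id_apply,
    integral_dirac' _ _ (hM.measurable_totalCost _).stronglyMeasurable, totalCost_last]

/-- Reward iteration: the value of a history is the mean of the values after the controller's
choice. -/
theorem Bounding.policyValue_castSucc (hM : M.ContinuityCompactness)
    (hb : M.Bounding α εl εu bl bu) (π : M.RandPolicy) (γ : M.NatPolicy) (k : Fin N)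
    (h : M.Hist k.castSucc) :
    Integrable (M.actionValue π γ k) ((π k).kernel h) ∧
      M.policyValue π γ k.castSucc h = ∫ r, M.actionValue π γ k r ∂(π k).kernel h := by
  have hi := hb.integrable_totalCost hM π γ k.castSucc h
  have hm := (hM.measurable_totalCost k.castSucc).stronglyMeasurable
  have hinner : ∀ r : M.HistAct k,
      ∫ h'', ∫ h', M.totalCost k.castSucc h' ∂M.law π γ k.succ h'' ∂(γ k).nextKernel r =
        M.actionValue π γ k r := by
    intro r
    rw [(γ k).nextKernel_apply, integral_map (measurable_next_left k r).aemeasurable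
      hm.integral_kernel.aestronglyMeasurable]
    refine integral_congr_ae (ae_of_all _ fun z => ?_)
    have h1 : ∫ h', M.totalCost k.castSucc h' ∂M.law π γ k.succ (M.next k (r, z)) =
        ∫ h', (M.c k (r.pair, M.T k (r.pair, z)) + M.totalCost k.succ h')
          ∂M.law π γ k.succ (M.next k (r, z)) := by
      refine integral_congr_ae ?_
      filter_upwards [ae_law_extends π γ k.succ (M.next k (r, z))] with h' hh'
      rw [totalCost_castSucc, hh'.pairAt_eq, hh'.state_succ_eq]
    simp only [h1]
    rw [integral_add (integrable_const _) (hb.integrable_totalCost hM π γ k.succ _)]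
    simp [policyValue]
  rw [law_castSucc] at hi
  have hi' := hi.integral_comp
  rw [step_eq] at hi'
  have hi'' := hi'.integral_comp
  simp only [hinner] at hi''
  refine ⟨hi'', ?_⟩
  rw [policyValue, law_castSucc, Kernel.integral_comp hi, step_eq, Kernel.integral_comp hi']
  simp only [hinner]

theorem Bounding.integrable_actionValue (hM : M.ContinuityCompactness)
    (hb : M.Bounding α εl εu bl bu) (π : M.RandPolicy) (γ : M.NatPolicy) (k : Fin N)
    (r : M.HistAct k) (Q : M.Amb k) :
    Integrable (fun z => M.c k (r.pair, M.T k (r.pair, z)) +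
      M.policyValue π γ k.succ (M.next k (r, z))) Q.measure := by
  obtain ⟨C, hC0, hC⟩ := hb.exists_abs_policyValue_le hM k.succ
  refine ⟨(((hM.measurable_cT k).comp measurable_prodMk_left).add
    ((hM.measurable_policyValue π γ k.succ).comp
      (measurable_next_left k r))).aestronglyMeasurable, ?_⟩
  refine lt_of_le_of_lt (lintegral_mono fun z => (enorm_add_le _ _).trans ?_)
    ((hb.lintegral_cost_add_drift_le hM k hC0 r.pair Q).trans_lt ENNReal.ofReal_lt_top)
  gcongr
  rw [Real.enorm_eq_ofReal_abs]
  exact ENNReal.ofReal_le_ofReal (last_next k r z ▸ hC π γ (M.next k (r, z)))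

end Value

end RobustMDP

namespace RobustMDP

/-! ### Optimality -/

variable {N : ℕ} {E A Z : Type*}
    [TopologicalSpace E] [TopologicalSpace.MetrizableSpace E] [SecondCountableTopology E]
    [MeasurableSpace E] [BorelSpace E]
    [TopologicalSpace A] [TopologicalSpace.MetrizableSpace A] [SecondCountableTopology A]
    [MeasurableSpace A] [BorelSpace A]
    [MeasurableSpace Z] {M : RobustMDP N E A Z} {α εl εu : ℝ} {bl bu : E → ℝ}

/-- Every state is the current state of a history: keep it constant and use actions of a measurable
selection of `D`. -/
theorem exists_hist_last_eq (M : RobustMDP N E A Z) (n : Fin (N + 1)) (x : E) :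
    ∃ h : M.Hist n, h.last = x := by
  choose d _ hd using M.exists_graph
  exact ⟨⟨(fun _ => x, fun j => d ⟨j, by have := n.isLt; omega⟩ x), fun j => hd _ x⟩, rfl⟩

theorem markovPolicyValue_last (π : M.MarkovPolicy) (γ : M.NatMarkovPolicy) :
    M.markovPolicyValue π γ (Fin.last N) = M.cN := by
  rw [markovPolicyValue, Fin.reverseInduction_last]

theorem markovPolicyValue_castSucc (π : M.MarkovPolicy) (γ : M.NatMarkovPolicy) (k : Fin N) :
    M.markovPolicyValue π γ k.castSucc =
      M.opPair k (π k) (γ k) (M.markovPolicyValue π γ k.succ) := by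
  rw [markovPolicyValue, Fin.reverseInduction_castSucc]
  rfl

/-- The value under a deterministic Markov rule of the controller at the stage `k`. -/
theorem Bounding.policyValue_castSucc_of_markov (hM : M.ContinuityCompactness)
    (hb : M.Bounding α εl εu bl bu) (π : M.MarkovPolicy) (γ : M.NatPolicy) (k : Fin N)
    (h : M.Hist k.castSucc) :
    M.policyValue π.toRand γ k.castSucc h =
      M.actionValue π.toRand γ k ⟨(h, (π k).toFun h.last), (π k).feasible _⟩ := by
  rw [(hb.policyValue_castSucc hM π.toRand γ k h).2]
  have h1 : ∀ᵐ r ∂(π.toRand k).kernel h, M.actionValue π.toRand γ k r =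
      M.actionValue π.toRand γ k ⟨(h, (π k).toFun h.last), (π k).feasible _⟩ := by
    filter_upwards [(π k).ae_kernel_toRand h] with r hr
    rw [hr]
  rw [integral_congr_ae h1]
  simp

/-- For pairs of Markov policies the value of a history depends on its current state only. -/
theorem Bounding.policyValue_eq_markovPolicyValue (hM : M.ContinuityCompactness)
    (hb : M.Bounding α εl εu bl bu) (π : M.MarkovPolicy) (γ : M.NatMarkovPolicy)
    (n : Fin (N + 1)) (h : M.Hist n) :
    M.policyValue π.toRand γ.toNat n h = M.markovPolicyValue π γ n h.last := by
  induction n using Fin.reverseInduction with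
  | last => rw [policyValue_last _ _ hM, markovPolicyValue_last]
  | cast k ih =>
    rw [hb.policyValue_castSucc_of_markov hM, markovPolicyValue_castSucc, actionValue]
    simp only [ih, last_next]
    rfl

/-- A solution of the Bellman equation in `𝔹`. -/
structure IsBellmanSolution (M : RobustMDP N E A Z) (b : E → ℝ) (J : Fin (N + 1) → E → ℝ) :
    Prop where
  mem : ∀ n, J n ∈ LscBounded b
  last : J (Fin.last N) = M.cN
  eq_op : ∀ (k : Fin N) (x : E), (J k.castSucc x : EReal) = M.op k (J k.succ) x

theorem Bounding.exists_isBellmanSolution (hM : M.ContinuityCompactness)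
    (hb : M.Bounding α εl εu bl bu) :
    ∃ J, M.IsBellmanSolution (fun x => bu x - bl x) J := by
  let J : Fin (N + 1) → E → ℝ := Fin.reverseInduction (motive := fun _ => E → ℝ) M.cN
    fun k v x => (M.op k v x).toReal
  have hlast : J (Fin.last N) = M.cN := Fin.reverseInduction_last
  have hcast : ∀ k : Fin N, J k.castSucc = fun x => (M.op k (J k.succ) x).toReal := fun k =>
    Fin.reverseInduction_castSucc k
  have hstep : ∀ k : Fin N, J k.succ ∈ LscBounded (fun x => bu x - bl x) →
      J k.castSucc ∈ LscBounded (fun x => bu x - bl x) ∧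
        ∀ x, (J k.castSucc x : EReal) = M.op k (J k.succ) x := by
    intro k hk
    obtain ⟨w, hw, hop, -⟩ := hb.exists_op_eq hM k hk
    have h1 : J k.castSucc = w := by
      rw [hcast]
      ext x
      rw [← hop, EReal.toReal_coe]
    rw [h1]
    exact ⟨hw, hop⟩
  have hmem : ∀ n, J n ∈ LscBounded (fun x => bu x - bl x) := by
    intro n
    induction n using Fin.reverseInduction with
    | last =>
      rw [hlast]
      refine ⟨hM.lowerSemicontinuous_cN.measurable, hM.lowerSemicontinuous_cN, 1, zero_le_one,
        fun x => abs_le.mpr ⟨?_, ?_⟩⟩ <;>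
      linarith [hb.terminal x, hb.bl_nonpos x, hb.bu_nonneg x]
    | cast k ih => exact (hstep k ih).1
  exact ⟨J, hmem, hlast, fun k => (hstep k (hmem k.succ)).2⟩

variable {J : Fin (N + 1) → E → ℝ}

theorem IsBellmanSolution.le_worstCase (hM : M.ContinuityCompactness)
    (hb : M.Bounding α εl εu bl bu) (hJ : M.IsBellmanSolution (fun x => bu x - bl x) J)
    (k : Fin N) (y : M.D k) : J k.castSucc y.1.1 ≤ M.worstCase k (J k.succ) y := by
  rw [← EReal.coe_le_coe_iff, hJ.eq_op, hb.coe_worstCase hM k (hJ.mem _)]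
  exact iInf_le (fun a : {a : A // (y.1.1, a) ∈ M.D k} =>
    ⨆ Q : M.Amb k, (M.L k (J k.succ) ⟨(y.1.1, a.1), a.2⟩ Q : EReal)) ⟨y.1.2, y.2⟩

theorem IsBellmanSolution.worstCase_eq (hM : M.ContinuityCompactness)
    (hb : M.Bounding α εl εu bl bu) (hJ : M.IsBellmanSolution (fun x => bu x - bl x) J)
    {k : Fin N} {d : M.MarkovRule k} (hd : M.IsMinimizer k (J k.succ) d) (x : E) :
    M.worstCase k (J k.succ) (d.pair x) = J k.castSucc x := by
  rw [← EReal.coe_eq_coe_iff, hJ.eq_op, hb.coe_worstCase hM k (hJ.mem _), ← hd x]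
  rfl

/-- An upper bound `v` for the value at the next stage bounds the value of a history with action by
`L_k v`. -/
theorem Bounding.actionValue_le (hM : M.ContinuityCompactness)
    (hb : M.Bounding α εl εu bl bu) {π : M.RandPolicy} {γ : M.NatPolicy} {k : Fin N}
    {v : E → ℝ} (hv : v ∈ LscBounded fun x => bu x - bl x)
    (hV : ∀ h, M.policyValue π γ k.succ h ≤ v h.last) (r : M.HistAct k) :
    M.actionValue π γ k r ≤ M.L k v r.pair ((γ k).toFun r) := by
  refine integral_mono (hb.integrable_actionValue hM π γ k r _)
    (hb.integrable_integrand hM k hv _ _) fun z => ?_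
  have := hV (M.next k (r, z))
  rw [last_next] at this
  exact add_le_add le_rfl this

theorem Bounding.le_actionValue (hM : M.ContinuityCompactness)
    (hb : M.Bounding α εl εu bl bu) {π : M.RandPolicy} {γ : M.NatPolicy} {k : Fin N}
    {v : E → ℝ} (hv : v ∈ LscBounded fun x => bu x - bl x) {δ : ℝ}
    (hV : ∀ h, v h.last - δ ≤ M.policyValue π γ k.succ h) (r : M.HistAct k) :
    M.L k v r.pair ((γ k).toFun r) - δ ≤ M.actionValue π γ k r := by
  have h1 : M.L k v r.pair ((γ k).toFun r) - δ =
      ∫ z, (M.integrand k v r.pair z - δ) ∂((γ k).toFun r).measure := by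
    rw [integral_sub (hb.integrable_integrand hM k hv _ _) (integrable_const _)]
    simp [L, integrand]
  rw [h1]
  refine integral_mono ((hb.integrable_integrand hM k hv _ _).sub (integrable_const _))
    (hb.integrable_actionValue hM π γ k r _) fun z => ?_
  have := hV (M.next k (r, z))
  rw [last_next] at this
  simp only [integrand]
  linarith

/-- Against Markov minimizers, no policy of nature, history-dependent or not, achieves more
than `J`. -/
theorem IsBellmanSolution.policyValue_le (hM : M.ContinuityCompactness)
    (hb : M.Bounding α εl εu bl bu) (hJ : M.IsBellmanSolution (fun x => bu x - bl x) J)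
    {π : M.MarkovPolicy} (hπ : ∀ k, M.IsMinimizer k (J k.succ) (π k)) (γ : M.NatPolicy)
    (n : Fin (N + 1)) (h : M.Hist n) : M.policyValue π.toRand γ n h ≤ J n h.last := by
  induction n using Fin.reverseInduction with
  | last => rw [policyValue_last _ _ hM, hJ.last]
  | cast k ih =>
    rw [hb.policyValue_castSucc_of_markov hM, ← hJ.worstCase_eq hM hb (hπ k)]
    exact (hb.actionValue_le hM (hJ.mem k.succ) ih _).trans
      (hb.L_le_worstCase hM k (hJ.mem k.succ) _ _)

/-- Against Markov rules of nature that are `ε`-optimal at each stage, no policy of the controller,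
randomized and history-dependent or not, falls below `J` by more than `ε` for each remaining
stage. -/
theorem IsBellmanSolution.le_policyValue (hM : M.ContinuityCompactness)
    (hb : M.Bounding α εl εu bl bu) (hJ : M.IsBellmanSolution (fun x => bu x - bl x) J)
    {γ : M.NatMarkovPolicy} {ε : ℝ}
    (hγ : ∀ k y, M.worstCase k (J k.succ) y ≤ M.L k (J k.succ) y ((γ k).toFun y) + ε)
    (π : M.RandPolicy) (n : Fin (N + 1)) (h : M.Hist n) :
    J n h.last - ((N : ℝ) - n.val) * ε ≤ M.policyValue π γ.toNat n h := by
  induction n using Fin.reverseInduction with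
  | last => simp [policyValue_last _ _ hM, hJ.last]
  | cast k ih =>
    obtain ⟨hi, heq⟩ := hb.policyValue_castSucc hM π γ.toNat k h
    have h1 : ∀ᵐ r ∂(π k).kernel h,
        J k.castSucc h.last - ((N : ℝ) - k.castSucc.val) * ε ≤ M.actionValue π γ.toNat k r := by
      filter_upwards [(π k).ae_kernel_hist_eq h] with r hr
      have h2 := hb.le_actionValue hM (hJ.mem k.succ) ih r
      have h3 := hγ k r.pair
      have h4 := hJ.le_worstCase hM hb k r.pair
      have h5 : r.pair.1.1 = h.last := hr ▸ rfl
      have h6 : (γ.toNat k).toFun r = (γ k).toFun r.pair := rfl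
      rw [h5] at h4
      rw [h6] at h2
      simp only [Fin.val_succ, Fin.val_castSucc, Nat.cast_add, Nat.cast_one] at h2 ⊢
      linarith
    rw [heq]
    have h2 := integral_mono_ae (integrable_const _) hi h1
    simpa using h2

/-- Nature has Markov policies that are almost optimal against all policies of the controller
simultaneously. -/
theorem IsBellmanSolution.exists_lt_policyValue (hM : M.ContinuityCompactness)
    (hb : M.Bounding α εl εu bl bu) (hJ : M.IsBellmanSolution (fun x => bu x - bl x) J)
    {n : Fin (N + 1)} {h : M.Hist n} {t : ℝ} (ht : t < J n h.last) :
    ∃ γ : M.NatMarkovPolicy, ∀ π, t < M.policyValue π γ.toNat n h := by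
  have hN : (0 : ℝ) < N + 1 := by positivity
  -- at most `N` stages lose `ε` each, which is less than `J n h.last - t` in total
  set ε := (J n h.last - t) / (N + 1) with hε
  have hε0 : 0 < ε := div_pos (sub_pos.mpr ht) hN
  choose γ hγ using fun k => hb.exists_natMarkovRule_le_add hM k (hJ.mem k.succ) hε0
  refine ⟨γ, fun π => lt_of_lt_of_le ?_ (hJ.le_policyValue hM hb hγ π n h)⟩
  have h1 : ε * (N + 1) = J n h.last - t := div_mul_cancel₀ _ hN.ne'
  have h2 : 0 ≤ (n.val : ℝ) * ε := by positivity
  nlinarith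

theorem IsBellmanSolution.le_robustPolicyValue (hM : M.ContinuityCompactness)
    (hb : M.Bounding α εl εu bl bu) (hJ : M.IsBellmanSolution (fun x => bu x - bl x) J)
    (π : M.RandPolicy) (n : Fin (N + 1)) (h : M.Hist n) :
    (J n h.last : EReal) ≤ M.robustPolicyValue π n h := by
  refine le_of_forall_lt fun c hc => ?_
  obtain ⟨t, hct, ht⟩ := EReal.lt_iff_exists_real_btwn.mp hc
  obtain ⟨γ, hγ⟩ := hJ.exists_lt_policyValue hM hb (EReal.coe_lt_coe_iff.mp ht)
  exact (hct.trans (EReal.coe_lt_coe_iff.mpr (hγ π))).trans_le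
    (le_iSup (fun γ => (M.policyValue π γ n h : EReal)) γ.toNat)

theorem IsBellmanSolution.le_robustMarkovPolicyValue (hM : M.ContinuityCompactness)
    (hb : M.Bounding α εl εu bl bu) (hJ : M.IsBellmanSolution (fun x => bu x - bl x) J)
    (π : M.MarkovPolicy) (n : Fin (N + 1)) (x : E) :
    (J n x : EReal) ≤ M.robustMarkovPolicyValue π n x := by
  obtain ⟨h, rfl⟩ := M.exists_hist_last_eq n x
  refine le_of_forall_lt fun c hc => ?_
  obtain ⟨t, hct, ht⟩ := EReal.lt_iff_exists_real_btwn.mp hc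
  obtain ⟨γ, hγ⟩ := hJ.exists_lt_policyValue hM hb (EReal.coe_lt_coe_iff.mp ht)
  have h1 := hγ π.toRand
  rw [hb.policyValue_eq_markovPolicyValue hM] at h1
  exact (hct.trans (EReal.coe_lt_coe_iff.mpr h1)).trans_le
    (le_iSup (fun γ => (M.markovPolicyValue π γ n h.last : EReal)) γ)

theorem IsBellmanSolution.robustPolicyValue_eq (hM : M.ContinuityCompactness)
    (hb : M.Bounding α εl εu bl bu) (hJ : M.IsBellmanSolution (fun x => bu x - bl x) J)
    {π : M.MarkovPolicy} (hπ : ∀ k, M.IsMinimizer k (J k.succ) (π k)) (n : Fin (N + 1))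
    (h : M.Hist n) : M.robustPolicyValue π.toRand n h = (J n h.last : EReal) :=
  le_antisymm
    (iSup_le fun γ => EReal.coe_le_coe_iff.mpr (hJ.policyValue_le hM hb hπ γ n h))
    (hJ.le_robustPolicyValue hM hb _ n h)

theorem IsBellmanSolution.robustMarkovPolicyValue_eq (hM : M.ContinuityCompactness)
    (hb : M.Bounding α εl εu bl bu) (hJ : M.IsBellmanSolution (fun x => bu x - bl x) J)
    {π : M.MarkovPolicy} (hπ : ∀ k, M.IsMinimizer k (J k.succ) (π k)) (n : Fin (N + 1)) (x : E) :
    M.robustMarkovPolicyValue π n x = (J n x : EReal) := by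
  refine le_antisymm (iSup_le fun γ => EReal.coe_le_coe_iff.mpr ?_)
    (hJ.le_robustMarkovPolicyValue hM hb π n x)
  obtain ⟨h, rfl⟩ := M.exists_hist_last_eq n x
  rw [← hb.policyValue_eq_markovPolicyValue hM]
  exact hJ.policyValue_le hM hb hπ _ n h

theorem IsBellmanSolution.eq_markovPolicyValue
    (hJ : M.IsBellmanSolution (fun x => bu x - bl x) J) {π : M.MarkovPolicy}
    {γ : M.NatMarkovPolicy}
    (hγ : ∀ k : Fin N, J k.castSucc = M.opPair k (π k) (γ k) (J k.succ)) (n : Fin (N + 1)) :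
    J n = M.markovPolicyValue π γ n := by
  induction n using Fin.reverseInduction with
  | last => rw [hJ.last, markovPolicyValue_last]
  | cast k ih => rw [hγ, markovPolicyValue_castSucc, ih]

end RobustMDP

end

theorem mainTheorem1 {N : ℕ} {E A Z : Type*}
    [TopologicalSpace E] [TopologicalSpace.MetrizableSpace E] [SecondCountableTopology E]
    [MeasurableSpace E] [BorelSpace E] [StandardBorelSpace E]
    [TopologicalSpace A] [TopologicalSpace.MetrizableSpace A] [SecondCountableTopology A]
    [MeasurableSpace A] [BorelSpace A] [StandardBorelSpace A]
    [MeasurableSpace Z] (M : RobustMDP N E A Z) (hM : M.ContinuityCompactness)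
    (α εl εu : ℝ) (bl bu : E → ℝ) (hb : M.Bounding α εl εu bl bu) :
    -- all policy values are integrals of integrable functions
    (∀ π γ n h, Integrable (M.totalCost n) (M.law π γ n h)) ∧
    -- for pairs of Markov policies, `V_{nπγ}(h_n) = J_{nπγ}(x_n)`
    (∀ (π : M.MarkovPolicy) (γ : M.NatMarkovPolicy) (n : Fin (N + 1)) (h : M.Hist n),
      M.policyValue π.toRand γ.toNat n h = M.markovPolicyValue π γ n h.last) ∧
    ∃ J : Fin (N + 1) → E → ℝ,
      -- `J n` is the (finite) Markovian value function, and `V_n(h_n) = J_n(x_n)`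
      (∀ n x, M.markovValue n x = (J n x : EReal)) ∧
      (∀ n (h : M.Hist n), M.robustValue n h = (J n h.last : EReal)) ∧
      (∀ n, J n ∈ LscBounded (fun x => bu x - bl x)) ∧
      -- Bellman equation, in which all integrals are integrals of integrable functions
      J (Fin.last N) = M.cN ∧
      (∀ (k : Fin N) (x : E), (J k.castSucc x : EReal) = M.op k (J k.succ) x) ∧
      (∀ (k : Fin N) (y : M.D k) (Q : M.Amb k),
        Integrable (fun z => M.c k (y, M.T k (y, z)) + J k.succ (M.T k (y, z))) Q.measure) ∧
      -- Markov minimizers exist, and every sequence of them is an optimal policy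
      (∀ k : Fin N, ∃ d : M.MarkovRule k, M.IsMinimizer k (J k.succ) d) ∧
      (∀ π : M.MarkovPolicy, (∀ k : Fin N, M.IsMinimizer k (J k.succ) (π k)) →
        ∀ n, (∀ x, M.robustMarkovPolicyValue π n x = (J n x : EReal)) ∧
          ∀ h : M.Hist n, M.robustPolicyValue π.toRand n h = M.robustValue n h) ∧
      -- weak* closed ambiguity sets: optimal Markov policies of nature
      ((∀ k : Fin N, M.WeakStarClosed k) →
        (∀ k : Fin N, ∃ γ : M.NatMarkovRule k,
          (∀ (y : M.D k) (Q : M.Amb k), M.L k (J k.succ) y Q ≤ M.L k (J k.succ) y (γ.toFun y)) ∧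
          ∀ d : M.MarkovRule k, M.IsMinimizer k (J k.succ) d →
            J k.castSucc = M.opPair k d γ (J k.succ)) ∧
        ∀ π : M.MarkovPolicy, (∀ k : Fin N, M.IsMinimizer k (J k.succ) (π k)) →
          ∀ γ : M.NatMarkovPolicy,
            (∀ k : Fin N, J k.castSucc = M.opPair k (π k) (γ k) (J k.succ)) →
            ∀ n, J n = M.markovPolicyValue π γ n ∧
              ∀ h : M.Hist n,
                (M.policyValue π.toRand γ.toNat n h : EReal)
                  = M.robustPolicyValue π.toRand n h) := by
  obtain ⟨J, hJ⟩ := hb.exists_isBellmanSolution hM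
  have hmin : ∀ k : Fin N, ∃ d : M.MarkovRule k, M.IsMinimizer k (J k.succ) d := fun k =>
    let ⟨_, _, _, h⟩ := hb.exists_op_eq hM k (hJ.mem k.succ)
    h
  have hV : ∀ n (h : M.Hist n), M.robustValue n h = (J n h.last : EReal) := by
    intro n h
    choose π hπ using hmin
    refine le_antisymm ?_ (le_iInf fun π => hJ.le_robustPolicyValue hM hb π n h)
    exact (iInf_le _ (RobustMDP.MarkovPolicy.toRand π)).trans
      (hJ.robustPolicyValue_eq hM hb hπ n h).le
  refine ⟨hb.integrable_totalCost hM, hb.policyValue_eq_markovPolicyValue hM, J, fun n x => ?_, hV,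
    hJ.mem, hJ.last, hJ.eq_op, fun k y Q => hb.integrable_integrand hM k (hJ.mem k.succ) y Q,
    hmin, fun π hπ n => ⟨hJ.robustMarkovPolicyValue_eq hM hb hπ n, fun h => ?_⟩, fun hcl =>
    ⟨fun k => ?_, fun π hπ γ hγ n => ⟨hJ.eq_markovPolicyValue hγ n, fun h => ?_⟩⟩⟩
  · choose π hπ using hmin
    refine le_antisymm ?_ (le_iInf fun π => hJ.le_robustMarkovPolicyValue hM hb π n x)
    exact (iInf_le _ π).trans (hJ.robustMarkovPolicyValue_eq hM hb hπ n x).le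
  · rw [hV, hJ.robustPolicyValue_eq hM hb hπ]
  · obtain ⟨γ, hγ⟩ := hb.exists_natMarkovRule_isMax hM k (hcl k) (hJ.mem k.succ)
    refine ⟨γ, hγ, fun d hd => funext fun x => ?_⟩
    rw [← hJ.worstCase_eq hM hb hd]
    exact le_antisymm (ciSup_le fun Q => hγ _ Q) (hb.L_le_worstCase hM k (hJ.mem k.succ) _ _)
  · rw [hb.policyValue_eq_markovPolicyValue hM, ← hJ.eq_markovPolicyValue hγ,
      hJ.robustPolicyValue_eq hM hb hπ]
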